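/- Let $n\ge 1$ be an integer and $\theta>0$, where either $n=1$ and $0<\theta<\tfrac14$, or $n\ge 2$ and $0<\theta\le\tfrac5{12}$. Let $L_\theta=\log(I+(-\Delta)^\theta)$ be the operator on $L^2(\mathbf R^n)$ which multiplies the Fourier transform $\hat f(\xi)=\int e^{-ix\cdot\xi}f(x)\,dx$ (extended to $L^2$) by $\log(1+|\xi|^{2\theta})$, with domain $\{f\in L^2:\ \log(1+|\xi|^{2\theta})\hat f\in L^2\}$. Let $L^{1,2\theta}(\mathbf R^n)$ be the space of $f\in L^1(\mathbf R^n)$ with $\|f\|_{L^{1,2\theta}}:=\int_{\mathbf R^n}(1+|x|^{2\theta})|f(x)|\,dx<\infty$. Then there are constants $K_1,K_2,T_0>0$ depending only on $n$ and $\theta$ such that the following holds for every (real- or complex-valued) $u_1\in L^{1,2\theta}(\mathbf R^n)\cap L^2(\mathbf R^n)$. The problem $$u_{tt}-\Delta u+L_\theta u_t=0\ \text{ in }(0,\infty)\times\mathbf R^n,\qquad u(0,\cdot)=0,\quad u_t(0,\cdot)=u_1,$$ has a unique mild solution $u\in C([0,\infty);H^1(\mathbf R^n))\cap C^1([0,\infty);L^2(\mathbf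 R^n))$, that is, a unique such $u$ with $u(0)=0$, $u_t(0)=u_1$ and $u_t(t)=u_1+\Delta\int_0^t u(s)\,ds-L_\theta u(t)$ in $L^2(\mathbf R^n)$ for all $t\ge0$; and with $P_1:=\int_{\mathbf R^n}u_1(x)\,dx$, $$\|u(t,\cdot)\|_{L^2}\le K_2\,\bigl(|P_1|+\|u_1\|_{L^{1,2\theta}}\bigr)\Bigl(t^{-\frac{n-4\theta}{4(1-\theta)}}+\tfrac1{\sqrt\theta}\,t^{-\frac{n-4\theta}{4\theta}}\Bigr)\qquad\text{for all } t\ge T_0,$$ and there is $T_1>0$, which may depend on $n$, $\theta$ and $u_1$, with $$K_1\,|P_1|\,t^{-\frac{n-4\theta}{4(1-\theta)}}\le\|u(t,\cdot)\|_{L^2}\qquad\text{for all } t\ge T_1.$$ -/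

import Mathlib

open MeasureTheory Set
open scoped FourierTransform SchwartzMap Laplacian

noncomputable section

/-- The complex Hilbert space `L²(ℝⁿ)`. -/
abbrev L2 (n : ℕ) : Type := Lp (α := EuclideanSpace ℝ (Fin n)) ℂ 2

/-- Membership in the weighted space `L^{1,γ}(ℝⁿ)`: `f` and `(1 + |x|^γ) f` are integrable. -/
def MemWeightedL1 {n : ℕ} (γ : ℝ) (f : EuclideanSpace ℝ (Fin n) → ℂ) : Prop :=
  Integrable f ∧ Integrable (fun x => (1 + ‖x‖ ^ γ) * ‖f x‖)

/-- The norm `‖f‖_{L^{1,γ}} = ∫ (1 + |x|^γ) |f(x)| dx`. -/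
def weightedL1Norm {n : ℕ} (γ : ℝ) (f : EuclideanSpace ℝ (Fin n) → ℂ) : ℝ :=
  ∫ x, (1 + ‖x‖ ^ γ) * ‖f x‖

/-- The symbol of `log (1 + (-Δ)^θ)`. Mathlib's Fourier transform has the kernel
`exp (-2πi x·ξ)`, so that `-Δ` has the symbol `(2π|ξ|)²`: the frequency which the convention
`exp (-i x·ξ)` calls `ξ` is `2πξ` here. -/
def logSymbol {n : ℕ} (θ : ℝ) (ξ : EuclideanSpace ℝ (Fin n)) : ℝ :=
  Real.log (1 + (2 * Real.pi * ‖ξ‖) ^ (2 * θ))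

/-- The function `logSymbol θ · f̂` on the frequency side. -/
def logFourier {n : ℕ} (θ : ℝ) (f : L2 n) (ξ : EuclideanSpace ℝ (Fin n)) : ℂ :=
  (logSymbol θ ξ : ℂ) * (𝓕 f : L2 n) ξ

theorem logFourier_add {n : ℕ} (θ : ℝ) (f g : L2 n) :
    logFourier θ (f + g) =ᵐ[volume] logFourier θ f + logFourier θ g := by
  have hfg : (𝓕 (f + g) : L2 n) = 𝓕 f + 𝓕 g := (Lp.fourierTransformₗᵢ _ ℂ).map_add f g
  filter_upwards [Lp.coeFn_add (𝓕 f : L2 n) (𝓕 g : L2 n)] with ξ h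
  simp only [logFourier, Pi.add_apply] at h ⊢
  rw [hfg, h, mul_add]

theorem logFourier_smul {n : ℕ} (θ : ℝ) (c : ℂ) (f : L2 n) :
    logFourier θ (c • f) =ᵐ[volume] c • logFourier θ f := by
  have hcf : (𝓕 (c • f) : L2 n) = c • 𝓕 f := (Lp.fourierTransformₗᵢ _ ℂ).map_smul c f
  filter_upwards [Lp.coeFn_smul c (𝓕 f : L2 n)] with ξ h
  simp only [logFourier, Pi.smul_apply, smul_eq_mul] at h ⊢
  rw [hcf, h]
  ring

/-- The domain of `L_θ`: the `f ∈ L²(ℝⁿ)` for which `logSymbol θ · f̂` is square integrable. -/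
def logDomain (n : ℕ) (θ : ℝ) : Submodule ℂ (L2 n) where
  carrier := {f | MemLp (logFourier θ f) 2 volume}
  add_mem' := fun {f g} hf hg => (memLp_congr_ae (logFourier_add θ f g)).2 (MemLp.add hf hg)
  zero_mem' := by
    have h := logFourier_smul θ 0 (0 : L2 n)
    rw [zero_smul, zero_smul] at h
    exact (memLp_congr_ae h).2 MemLp.zero
  smul_mem' := fun c f hf => (memLp_congr_ae (logFourier_smul θ c f)).2 (MemLp.const_smul hf c)

theorem memLp_of_mem_logDomain {n : ℕ} {θ : ℝ} {f : L2 n} (hf : f ∈ logDomain n θ) :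
    MemLp (logFourier θ f) 2 volume := hf

/-- The unbounded operator `L_θ = log (1 + (-Δ)^θ)` on `L²(ℝⁿ)`: `L_θ f` is the inverse Fourier
transform of `logSymbol θ · f̂`. -/
def logDamping (n : ℕ) (θ : ℝ) : L2 n →ₗ.[ℂ] L2 n where
  domain := logDomain n θ
  toFun :=
    { toFun := fun f => 𝓕⁻ (MemLp.toLp (logFourier θ (f : L2 n)) (memLp_of_mem_logDomain f.2) : L2 n)
      map_add' := by
        intro f g
        have h : (MemLp.toLp (logFourier θ ((f + g : logDomain n θ) : L2 n)) (memLp_of_mem_logDomain (f + g).2) : L2 n) =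
            MemLp.toLp (logFourier θ (f : L2 n)) (memLp_of_mem_logDomain f.2) + MemLp.toLp (logFourier θ (g : L2 n)) (memLp_of_mem_logDomain g.2) := by
          exact (MemLp.toLp_congr _ ((memLp_of_mem_logDomain f.2).add (memLp_of_mem_logDomain g.2))
            (logFourier_add θ _ _)).trans (MemLp.toLp_add _ _)
        rw [h]
        exact (Lp.fourierTransformₗᵢ _ ℂ).symm.map_add _ _
      map_smul' := by
        intro c f
        have h : (MemLp.toLp (logFourier θ ((c • f : logDomain n θ) : L2 n)) (memLp_of_mem_logDomain (c • f).2) : L2 n) =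
            c • MemLp.toLp (logFourier θ (f : L2 n)) (memLp_of_mem_logDomain f.2) := by
          exact (MemLp.toLp_congr _ ((memLp_of_mem_logDomain f.2).const_smul c)
            (logFourier_smul θ _ _)).trans (MemLp.toLp_const_smul _ _)
        rw [h]
        exact (Lp.fourierTransformₗᵢ _ ℂ).symm.map_smul _ _ }

/-- `u` belongs to `C([0,∞); H¹(ℝⁿ))`: on `[0,∞)` the Bessel potential of order one of `u t` is
given by an `L²` function which depends continuously on `t`. -/
def ContinuousIntoH1 {n : ℕ} (u : ℝ → L2 n) : Prop :=
  ∃ w : ℝ → L2 n, ContinuousOn w (Ici 0) ∧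
    ∀ t ∈ Ici (0 : ℝ), TemperedDistribution.besselPotential (EuclideanSpace ℝ (Fin n)) ℂ 1
      (u t : 𝓢'(EuclideanSpace ℝ (Fin n), ℂ)) = (w t : 𝓢'(EuclideanSpace ℝ (Fin n), ℂ))

/-- `u` is a mild solution in `C([0,∞); H¹) ∩ C¹([0,∞); L²)` of `u_tt - Δu + L_θ u_t = 0`,
`u(0) = u₀`, `u_t(0) = u₁`.

Mild solutions of the first order system `U' = A U` for `U = (u, u_t)`,
`A (u, v) = (v, Δu - L_θ v)`, are the continuous `U` with `∫₀ᵗ U ∈ D(A)` and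
`U(t) = U(0) + A ∫₀ᵗ U`. As `∫₀ᵗ u_t = u(t) - u₀`, this says
`u_t(t) = u₁ + Δ ∫₀ᵗ u - L_θ (u(t) - u₀)` in `L²`, where `Δ` is the distributional Laplacian
(an `L²` function lies in `H²` exactly if its distributional Laplacian lies in `L²`).
Only the values `u t` with `t ≥ 0` matter. -/
structure IsMildSolution {n : ℕ} (θ : ℝ) (u₀ u₁ : L2 n) (u : ℝ → L2 n) : Prop where
  continuousIntoH1 : ContinuousIntoH1 u
  initial : u 0 = u₀
  equation : ∃ v : ℝ → L2 n, ContinuousOn v (Ici 0) ∧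
    (∀ t ∈ Ici (0 : ℝ), HasDerivWithinAt u (v t) (Ici 0) t) ∧
    v 0 = u₁ ∧
    ∀ t ∈ Ici (0 : ℝ), ∃ h : u t - u₀ ∈ (logDamping n θ).domain,
      ((v t - u₁ + logDamping n θ ⟨u t - u₀, h⟩ : L2 n) : 𝓢'(EuclideanSpace ℝ (Fin n), ℂ)) =
        Δ ((∫ s in (0 : ℝ)..t, u s : L2 n) : 𝓢'(EuclideanSpace ℝ (Fin n), ℂ))

end

/-! The Fourier transform decouples the problem. With `r = 2π|ξ|` and `a = log (1 + r ^ (2θ))`, one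
has `û(t, ξ) = G(t) û₁(ξ)`, where `G'' + a G' + r² G = 0`, `G(0) = 0`, `G'(0) = 1`. The hypotheses
on `n` and `θ` enter through `θ < 1/2` and `4θ < n`.

Well-posedness: the energy `G'² + r² G²` decreases from `1`, so `G`, `G'`, `r G` and `∫ G` are
multipliers bounded uniformly in `ξ ≠ 0` on bounded time intervals, and dominated convergence makes
`u` a mild solution (`isMildSolution_fourierSolution`). After a frequency cut-off the difference of
two solutions obeys a linear ODE with bounded coefficients, hence vanishes
(`IsMildSolution.unique`).

Upper bound (`exists_norm_fourierSolution_le`): near `r = 0` the damping `a ≈ r ^ (2θ)` dominates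
`r`, as `θ < 1/2`. The oscillator is overdamped with slow root about `-r² / a ≈ -r ^ (2 - 2θ)` and
amplitude of order `1 / a`, so `G²` is at most of order `r ^ (-4θ) exp (-r ^ (2 - 2θ) t)`. This is
integrable as `4θ < n`, and scaling gives the squared rate. Elsewhere `|G| ≤ t exp (-c a t) = t (1 +
r ^ (2θ)) ^ (-c t)`, which is exponentially small in time and, for large `t`, square integrable in
`ξ`. As `|û₁| ≤ ∫ |u₁|`, that part is negligible, and the first power of `t` alone already bounds
the norm.

Lower bound (`exists_le_norm_fourierSolution`): `û₁` is continuous with `û₁(0) = P₁`, so it suffices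
to integrate over one ball at frequencies comparable to `t ^ (-1 / (2 - 2θ))`. -/

noncomputable section

open Filter Topology

/-! ### The scalar damped oscillator: explicit solution and energy bounds -/

/-- The solution of `S'' = d S` with `S 0 = 0`, `S' 0 = 1`. -/
def genSinh (d t : ℝ) : ℝ :=
  if d = 0 then t else if 0 < d then Real.sinh (√d * t) / √d else Real.sin (√(-d) * t) / √(-d)

/-- The solution of `C'' = d C` with `C 0 = 1`, `C' 0 = 0`. -/
def genCosh (d t : ℝ) : ℝ :=
  if 0 < d then Real.cosh (√d * t) else Real.cos (√(-d) * t)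

theorem hasDerivAt_genSinh (d t : ℝ) : HasDerivAt (genSinh d) (genCosh d t) t := by
  unfold genSinh genCosh
  rcases lt_trichotomy d 0 with hd | rfl | hd
  · have h : √(-d) ≠ 0 := (Real.sqrt_pos.2 (by linarith)).ne'
    simp only [hd.ne, hd.not_gt, if_false]
    have := (((hasDerivAt_id t).const_mul √(-d)).sin).div_const √(-d)
    simpa [h] using this
  · simpa using hasDerivAt_id' t
  · have h : √d ≠ 0 := (Real.sqrt_pos.2 hd).ne'
    simp only [hd.ne', hd, if_false, if_true]
    have := (((hasDerivAt_id t).const_mul √d).sinh).div_const √d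
    simpa [h] using this

theorem hasDerivAt_genCosh (d t : ℝ) : HasDerivAt (genCosh d) (d * genSinh d t) t := by
  unfold genSinh genCosh
  rcases lt_trichotomy d 0 with hd | rfl | hd
  · have h : √(-d) ≠ 0 := (Real.sqrt_pos.2 (by linarith)).ne'
    simp only [hd.ne, hd.not_gt, if_false]
    have := ((hasDerivAt_id t).const_mul √(-d)).cos
    refine this.congr_deriv ?_
    have hs := Real.sq_sqrt (show 0 ≤ -d by linarith)
    have : d = -√(-d) ^ 2 := by linarith
    generalize √(-d) = m at *
    subst this
    simp only [id]
    field_simp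
  · simpa using hasDerivAt_const t (1 : ℝ)
  · have h : √d ≠ 0 := (Real.sqrt_pos.2 hd).ne'
    simp only [hd.ne', hd, if_false, if_true]
    have := ((hasDerivAt_id t).const_mul √d).cosh
    refine this.congr_deriv ?_
    have hs := Real.sq_sqrt hd.le
    generalize √d = m at *
    subst hs
    simp only [id]
    field_simp

theorem genSinh_zero (d : ℝ) : genSinh d 0 = 0 := by simp [genSinh]

theorem genCosh_zero (d : ℝ) : genCosh d 0 = 1 := by simp [genCosh]

/-- For `d < 0` the convention `√d = 0` turns the right side into `1`, which bounds the cosine; one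
formula thus serves both regimes. -/
theorem abs_genCosh_le (d : ℝ) {t : ℝ} (ht : 0 ≤ t) : |genCosh d t| ≤ Real.exp (√d * t) := by
  unfold genCosh
  have h0 : 0 ≤ √d * t := by positivity
  split_ifs with hd
  · rw [abs_of_pos (Real.cosh_pos _), Real.cosh_eq]
    have : Real.exp (-(√d * t)) ≤ Real.exp (√d * t) := Real.exp_le_exp.2 (by linarith)
    linarith
  · exact (Real.abs_cos_le_one _).trans (Real.one_le_exp h0)

theorem abs_genSinh_le (d : ℝ) {t : ℝ} (ht : 0 ≤ t) :
    |genSinh d t| ≤ t * Real.exp (√d * t) := by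
  have := (convex_Icc (0 : ℝ) t).norm_image_sub_le_of_norm_hasDerivWithin_le
    (f := genSinh d) (C := Real.exp (√d * t))
    (fun x _ => (hasDerivAt_genSinh d x).hasDerivWithinAt)
    (fun x hx => (abs_genCosh_le d hx.1).trans
      (Real.exp_le_exp.2 (mul_le_mul_of_nonneg_left hx.2 (Real.sqrt_nonneg d))))
    (left_mem_Icc.2 ht) (right_mem_Icc.2 ht)
  simpa [genSinh_zero, abs_of_nonneg ht, mul_comm] using this

theorem measurable_genSinh (t : ℝ) : Measurable fun d => genSinh d t := by
  unfold genSinh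
  refine Measurable.ite (measurableSet_singleton 0) measurable_const
    (Measurable.ite measurableSet_Ioi ?_ ?_) <;> fun_prop

theorem measurable_genCosh (t : ℝ) : Measurable fun d => genCosh d t := by
  unfold genCosh
  refine Measurable.ite measurableSet_Ioi ?_ ?_ <;> fun_prop

/-- The solution of `G'' + a G' + b² G = 0` with `G 0 = 0`, `G' 0 = 1`. -/
def dampedKernel (a b t : ℝ) : ℝ := Real.exp (-(a / 2) * t) * genSinh (a ^ 2 / 4 - b ^ 2) t

/-- The time derivative of `dampedKernel`. -/
def dampedKernelDeriv (a b t : ℝ) : ℝ :=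
  Real.exp (-(a / 2) * t) *
    (genCosh (a ^ 2 / 4 - b ^ 2) t - a / 2 * genSinh (a ^ 2 / 4 - b ^ 2) t)

/-- The primitive of `dampedKernel` which vanishes at time zero, when `b ≠ 0`. -/
def dampedKernelPrim (a b t : ℝ) : ℝ :=
  (1 - dampedKernelDeriv a b t - a * dampedKernel a b t) / b ^ 2

theorem dampedKernel_zero (a b : ℝ) : dampedKernel a b 0 = 0 := by
  simp [dampedKernel, genSinh_zero]

theorem dampedKernelDeriv_zero (a b : ℝ) : dampedKernelDeriv a b 0 = 1 := by
  simp [dampedKernelDeriv, genSinh_zero, genCosh_zero]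

theorem dampedKernelPrim_zero (a b : ℝ) : dampedKernelPrim a b 0 = 0 := by
  simp [dampedKernelPrim, dampedKernel_zero, dampedKernelDeriv_zero]

theorem hasDerivAt_dampedKernel (a b t : ℝ) :
    HasDerivAt (dampedKernel a b) (dampedKernelDeriv a b t) t := by
  unfold dampedKernel
  have he := ((hasDerivAt_id t).const_mul (-(a / 2))).exp
  refine (he.mul (hasDerivAt_genSinh (a ^ 2 / 4 - b ^ 2) t)).congr_deriv ?_
  simp only [dampedKernelDeriv, id]
  ring

theorem hasDerivAt_dampedKernelDeriv (a b t : ℝ) :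
    HasDerivAt (dampedKernelDeriv a b)
      (-a * dampedKernelDeriv a b t - b ^ 2 * dampedKernel a b t) t := by
  have he := ((hasDerivAt_id t).const_mul (-(a / 2))).exp
  have := he.mul ((hasDerivAt_genCosh (a ^ 2 / 4 - b ^ 2) t).sub
    ((hasDerivAt_genSinh (a ^ 2 / 4 - b ^ 2) t).const_mul (a / 2)))
  refine this.congr_deriv ?_
  simp only [dampedKernelDeriv, dampedKernel, id, Pi.sub_apply]
  ring

theorem hasDerivAt_dampedKernelPrim (a : ℝ) {b : ℝ} (hb : b ≠ 0) (t : ℝ) :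
    HasDerivAt (dampedKernelPrim a b) (dampedKernel a b t) t := by
  have := (((hasDerivAt_dampedKernelDeriv a b t).const_sub 1).sub
    ((hasDerivAt_dampedKernel a b t).const_mul a)).div_const (b ^ 2)
  refine this.congr_deriv ?_
  field_simp
  ring

/-- The oscillator equation integrated once in time. Multiplied by `û₁` it is the mild equation on
the frequency side. -/
theorem dampedKernelDeriv_add (a : ℝ) {b : ℝ} (hb : b ≠ 0) (t : ℝ) :
    dampedKernelDeriv a b t - 1 + a * dampedKernel a b t = -(b ^ 2 * dampedKernelPrim a b t) := by
  unfold dampedKernelPrim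
  field_simp
  ring

/-- The energy has derivative `-2 a G'²` and starts at `1`. All bounds needed for existence, uniform
in the frequency, come from here. -/
theorem dampedKernel_energy_le {a b t : ℝ} (ha : 0 ≤ a) (ht : 0 ≤ t) :
    dampedKernelDeriv a b t ^ 2 + b ^ 2 * dampedKernel a b t ^ 2 ≤ 1 := by
  have hd : ∀ x, HasDerivAt (fun t => dampedKernelDeriv a b t ^ 2 + b ^ 2 * dampedKernel a b t ^ 2)
      (-(2 * a * dampedKernelDeriv a b x ^ 2)) x := fun x => by
    have := ((hasDerivAt_dampedKernelDeriv a b x).pow 2).add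
      (((hasDerivAt_dampedKernel a b x).pow 2).const_mul (b ^ 2))
    refine this.congr_deriv ?_
    push_cast
    ring
  have hanti := antitone_of_hasDerivAt_nonpos hd fun x => by
    have : 0 ≤ 2 * a * dampedKernelDeriv a b x ^ 2 := by positivity
    exact neg_nonpos.2 this
  simpa [dampedKernel_zero, dampedKernelDeriv_zero] using hanti ht

theorem abs_dampedKernelDeriv_le {a b t : ℝ} (ha : 0 ≤ a) (ht : 0 ≤ t) :
    |dampedKernelDeriv a b t| ≤ 1 := by
  rw [← sq_le_one_iff_abs_le_one]
  nlinarith [dampedKernel_energy_le (b := b) ha ht, sq_nonneg (b * dampedKernel a b t)]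

theorem abs_mul_dampedKernel_le {a b t : ℝ} (ha : 0 ≤ a) (ht : 0 ≤ t) :
    |b * dampedKernel a b t| ≤ 1 := by
  rw [← sq_le_one_iff_abs_le_one]
  nlinarith [dampedKernel_energy_le (b := b) ha ht, sq_nonneg (dampedKernelDeriv a b t)]

theorem abs_dampedKernel_le {a b t : ℝ} (ha : 0 ≤ a) (ht : 0 ≤ t) :
    |dampedKernel a b t| ≤ t := by
  have := (convex_Icc (0 : ℝ) t).norm_image_sub_le_of_norm_hasDerivWithin_le
    (f := dampedKernel a b) (C := 1)
    (fun x _ => (hasDerivAt_dampedKernel a b x).hasDerivWithinAt)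
    (fun x hx => abs_dampedKernelDeriv_le ha hx.1)
    (left_mem_Icc.2 ht) (right_mem_Icc.2 ht)
  simpa [dampedKernel_zero, abs_of_nonneg ht] using this

theorem abs_dampedKernelPrim_le {a b t : ℝ} (ha : 0 ≤ a) (hb : b ≠ 0) (ht : 0 ≤ t) :
    |dampedKernelPrim a b t| ≤ t * t := by
  have := (convex_Icc (0 : ℝ) t).norm_image_sub_le_of_norm_hasDerivWithin_le
    (f := dampedKernelPrim a b) (C := t)
    (fun x _ => (hasDerivAt_dampedKernelPrim a hb x).hasDerivWithinAt)
    (fun x hx => (abs_dampedKernel_le ha hx.1).trans hx.2)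
    (left_mem_Icc.2 ht) (right_mem_Icc.2 ht)
  simpa [dampedKernelPrim_zero, abs_of_nonneg ht] using this

theorem measurable_dampedKernel {α : Type*} [MeasurableSpace α] {a b : α → ℝ} (ha : Measurable a)
    (hb : Measurable b) (t : ℝ) : Measurable fun x => dampedKernel (a x) (b x) t := by
  have := (measurable_genSinh t).comp (f := fun x => a x ^ 2 / 4 - b x ^ 2) (by fun_prop)
  unfold dampedKernel
  exact Measurable.mul (by fun_prop) this

theorem measurable_dampedKernelDeriv {α : Type*} [MeasurableSpace α] {a b : α → ℝ}
    (ha : Measurable a) (hb : Measurable b) (t : ℝ) :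
    Measurable fun x => dampedKernelDeriv (a x) (b x) t := by
  have h1 := (measurable_genSinh t).comp (f := fun x => a x ^ 2 / 4 - b x ^ 2) (by fun_prop)
  have h2 := (measurable_genCosh t).comp (f := fun x => a x ^ 2 / 4 - b x ^ 2) (by fun_prop)
  unfold dampedKernelDeriv
  exact Measurable.mul (by fun_prop) (h2.sub ((ha.div_const 2).mul h1))

theorem measurable_dampedKernelPrim {α : Type*} [MeasurableSpace α] {a b : α → ℝ}
    (ha : Measurable a) (hb : Measurable b) (t : ℝ) :
    Measurable fun x => dampedKernelPrim (a x) (b x) t :=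
  ((measurable_const.sub (measurable_dampedKernelDeriv ha hb t)).sub
    (ha.mul (measurable_dampedKernel ha hb t))).div (hb.pow_const 2)

/-! ### Decay of the oscillator in time -/

/-- `(a/2 - c a)² ≥ a²/4 - c a² ≥ a²/4 - b²`; a negative discriminant is covered by `√ = 0`. The
parameter `c` is constant at high frequencies and `b²/a²` at low ones. -/
theorem sqrt_discr_sub_le {a b c : ℝ} (ha : 0 ≤ a) (hc : c ≤ 1 / 2) (hb : c * a ^ 2 ≤ b ^ 2) :
    √(a ^ 2 / 4 - b ^ 2) - a / 2 ≤ -(c * a) := by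
  have h : √(a ^ 2 / 4 - b ^ 2) ≤ a / 2 - c * a :=
    Real.sqrt_le_iff.2 ⟨by nlinarith, by nlinarith [sq_nonneg (c * a)]⟩
  linarith

/-- The factor `t` is the price for uniformity through critical damping, where the two roots meet.
-/
theorem abs_dampedKernel_le_exp {a b c t : ℝ} (ha : 0 ≤ a) (hc : c ≤ 1 / 2)
    (hb : c * a ^ 2 ≤ b ^ 2) (ht : 0 ≤ t) :
    |dampedKernel a b t| ≤ t * Real.exp (-(c * a * t)) := by
  rw [dampedKernel, abs_mul, Real.abs_exp]
  calc _ ≤ Real.exp (-(a / 2) * t) * (t * Real.exp (√(a ^ 2 / 4 - b ^ 2) * t)) := by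
        gcongr; exact abs_genSinh_le _ ht
    _ = t * Real.exp ((√(a ^ 2 / 4 - b ^ 2) - a / 2) * t) := by
        rw [mul_left_comm, ← Real.exp_add]; ring_nf
    _ ≤ _ := by
        rw [← neg_mul]
        gcongr
        exact sqrt_discr_sub_le ha hc hb

theorem dampedKernel_eq_of_overdamped {a b : ℝ} (h : 0 < a ^ 2 / 4 - b ^ 2) (t : ℝ) :
    dampedKernel a b t = (Real.exp ((√(a ^ 2 / 4 - b ^ 2) - a / 2) * t) -
      Real.exp (-(√(a ^ 2 / 4 - b ^ 2) + a / 2) * t)) / (2 * √(a ^ 2 / 4 - b ^ 2)) := by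
  rw [dampedKernel, genSinh, if_neg h.ne', if_pos h, Real.sinh_eq]
  set m := √(a ^ 2 / 4 - b ^ 2)
  rw [show (m - a / 2) * t = -(a / 2) * t + m * t by ring,
    show -(m + a / 2) * t = -(a / 2) * t + -(m * t) by ring, Real.exp_add, Real.exp_add]
  have : m ≠ 0 := (Real.sqrt_pos.2 h).ne'
  field_simp

/-- `3/16 = 1/4 - 1/16`, which leaves a discriminant of at least `(a/4)²` and keeps the roots apart.
-/
theorem le_sqrt_discr {a b : ℝ} (hb : b ^ 2 ≤ 3 / 16 * a ^ 2) :
    a / 4 ≤ √(a ^ 2 / 4 - b ^ 2) :=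
  Real.le_sqrt_of_sq_le (by nlinarith)

theorem abs_dampedKernel_le_of_overdamped {a b t : ℝ} (ha : 0 < a)
    (hb : b ^ 2 ≤ 3 / 16 * a ^ 2) (ht : 0 ≤ t) :
    |dampedKernel a b t| ≤ 2 / a * Real.exp (-(b ^ 2 / a * t)) := by
  have hd : 0 < a ^ 2 / 4 - b ^ 2 := by nlinarith [pow_pos ha 2]
  rw [dampedKernel_eq_of_overdamped hd]
  have hm := le_sqrt_discr hb
  -- This `c` turns the hypothesis `c * a ^ 2 ≤ b ^ 2` into an equality and the rate `c * a` into `b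
  -- ^ 2 / a`.
  have hs := sqrt_discr_sub_le (a := a) (b := b) (c := b ^ 2 / a ^ 2) ha.le
    (by rw [div_le_iff₀ (by positivity)]; nlinarith [pow_pos ha 2])
    (by field_simp; rfl)
  have e : b ^ 2 / a ^ 2 * a = b ^ 2 / a := by field_simp
  rw [e] at hs
  set m := √(a ^ 2 / 4 - b ^ 2)
  have hm0 : 0 < m := by linarith
  have h1 : Real.exp (-(m + a / 2) * t) ≤ Real.exp ((m - a / 2) * t) :=
    Real.exp_le_exp.2 (mul_le_mul_of_nonneg_right (by linarith) ht)
  rw [abs_of_nonneg (div_nonneg (by linarith) (by positivity))]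
  calc _ ≤ Real.exp ((m - a / 2) * t) / (2 * (a / 4)) := by
        gcongr
        linarith [Real.exp_pos (-(m + a / 2) * t)]
    _ = 2 / a * Real.exp ((m - a / 2) * t) := by field_simp; ring
    _ ≤ _ := by
        rw [← neg_mul]
        gcongr

/-- The slow root equals `-b² / (m + a/2) ≥ -2 b² / a`, with `m` the root of the discriminant. Since
`m ≥ a/4`, the condition `2 ≤ a t` gives `exp (-2 m t) ≤ 1/2`, so the fast exponential removes at
most half of the slow one. -/
theorem le_dampedKernel_of_overdamped {a b t : ℝ} (ha : 0 < a)
    (hb : b ^ 2 ≤ 3 / 16 * a ^ 2) (ht : 2 ≤ a * t) :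
    Real.exp (-(2 * b ^ 2 / a * t)) / (2 * a) ≤ dampedKernel a b t := by
  have hd : 0 < a ^ 2 / 4 - b ^ 2 := by nlinarith [pow_pos ha 2]
  have ht0 : 0 < t := pos_of_mul_pos_right (by linarith) ha.le
  rw [dampedKernel_eq_of_overdamped hd]
  have hm := le_sqrt_discr hb
  have hsq := Real.sq_sqrt hd.le
  have hle : √(a ^ 2 / 4 - b ^ 2) ≤ a / 2 :=
    Real.sqrt_le_iff.2 ⟨by linarith, by nlinarith [sq_nonneg b]⟩
  set m := √(a ^ 2 / 4 - b ^ 2)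
  have hm0 : 0 < m := by linarith
  have hexp : -(2 * b ^ 2 / a) ≤ m - a / 2 := by
    rw [← neg_div, div_le_iff₀ ha]
    nlinarith
  have h1 : Real.exp (-(m + a / 2) * t) ≤ Real.exp ((m - a / 2) * t) / 2 := by
    rw [show -(m + a / 2) * t = (m - a / 2) * t + -(2 * m * t) by ring, Real.exp_add, div_eq_mul_inv]
    refine mul_le_mul_of_nonneg_left ?_ (Real.exp_pos _).le
    rw [Real.exp_neg]
    refine inv_anti₀ two_pos ?_
    have : 1 ≤ 2 * m * t := by nlinarith
    linarith [Real.add_one_le_exp (2 * m * t)]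
  calc _ ≤ Real.exp ((m - a / 2) * t) / (2 * a) := by
        rw [← neg_mul]
        exact div_le_div_of_nonneg_right (Real.exp_le_exp.2
          (mul_le_mul_of_nonneg_right hexp ht0.le)) (by positivity)
    _ = Real.exp ((m - a / 2) * t) / 2 / (2 * (a / 2)) := by field_simp
    _ ≤ Real.exp ((m - a / 2) * t) / 2 / (2 * m) := by gcongr
    _ ≤ _ := by
        gcongr
        linarith

/-! ### Distributional operators as pointwise identities in frequency -/

/-- On the frequency side, multiplication of an `L²` function by a temperate function in the sense
of distributions is pointwise multiplication, whenever the result is in `L²`. -/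
theorem smulLeftCLM_eq_iff {n : ℕ} {m : EuclideanSpace ℝ (Fin n) → ℂ} (hm : m.HasTemperateGrowth)
    (f g : L2 n) :
    TemperedDistribution.smulLeftCLM ℂ m (f : 𝓢'(EuclideanSpace ℝ (Fin n), ℂ)) =
      (g : 𝓢'(EuclideanSpace ℝ (Fin n), ℂ)) ↔ g =ᵐ[volume] fun ξ => m ξ * f ξ := by
  have key : ∀ φ : 𝓢(EuclideanSpace ℝ (Fin n), ℂ),
      TemperedDistribution.smulLeftCLM ℂ m (f : 𝓢'(EuclideanSpace ℝ (Fin n), ℂ)) φ =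
        ∫ ξ, φ ξ • (m ξ * f ξ) := fun φ => by
    rw [TemperedDistribution.smulLeftCLM_apply_apply, Lp.toTemperedDistribution_apply]
    congr 1 with ξ
    simp [hm, mul_assoc, mul_left_comm]
  constructor
  · intro h
    have hf : LocallyIntegrable (f : EuclideanSpace ℝ (Fin n) → ℂ) :=
      (Lp.memLp f).locallyIntegrable (by norm_num)
    have hg : LocallyIntegrable (g : EuclideanSpace ℝ (Fin n) → ℂ) :=
      (Lp.memLp g).locallyIntegrable (by norm_num)
    refine ae_eq_of_integral_contDiff_smul_eq hg
      (hf.continuous_mul hm.1.continuous) fun φ hφ hc => ?_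
    have hg₁ : HasCompactSupport (Complex.ofRealCLM ∘ φ) := hc.comp_left rfl
    have hg₂ : ContDiff ℝ (⊤ : ℕ∞) (Complex.ofRealCLM ∘ φ) := by fun_prop
    have h1 := key (hg₁.toSchwartzMap hg₂)
    rw [h, Lp.toTemperedDistribution_apply] at h1
    simpa using h1
  · intro h
    ext φ
    rw [key, Lp.toTemperedDistribution_apply]
    refine integral_congr_ae ?_
    filter_upwards [h] with ξ hξ
    rw [hξ]

/-- This translates the Laplacian and the Bessel potential, which the notion of mild solution takes
in tempered distributions, into a.e. identities of `L²` functions. -/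
theorem fourierMultiplierCLM_eq_iff {n : ℕ} {m : EuclideanSpace ℝ (Fin n) → ℂ}
    (hm : m.HasTemperateGrowth) (f g : L2 n) :
    TemperedDistribution.fourierMultiplierCLM ℂ m (f : 𝓢'(EuclideanSpace ℝ (Fin n), ℂ)) =
      (g : 𝓢'(EuclideanSpace ℝ (Fin n), ℂ)) ↔
      (𝓕 g : L2 n) =ᵐ[volume] fun ξ => m ξ * (𝓕 f : L2 n) ξ := by
  rw [← smulLeftCLM_eq_iff hm, ← Lp.fourier_toTemperedDistribution_eq,
    ← Lp.fourier_toTemperedDistribution_eq, TemperedDistribution.fourierMultiplierCLM_apply]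
  constructor
  · rintro h
    rw [← h, FourierTransform.fourier_fourierInv_eq]
  · rintro h
    rw [h, FourierTransform.fourierInv_fourier_eq]

theorem laplacian_eq_iff {n : ℕ} (f g : L2 n) :
    (g : 𝓢'(EuclideanSpace ℝ (Fin n), ℂ)) = Δ (f : 𝓢'(EuclideanSpace ℝ (Fin n), ℂ)) ↔
      (𝓕 g : L2 n) =ᵐ[volume]
        fun ξ => -(((2 * Real.pi * ‖ξ‖) ^ 2 : ℝ) : ℂ) * (𝓕 f : L2 n) ξ := by
  have e : Δ (f : 𝓢'(EuclideanSpace ℝ (Fin n), ℂ)) =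
      TemperedDistribution.fourierMultiplierCLM ℂ
        (fun ξ => -(((2 * Real.pi * ‖ξ‖) ^ 2 : ℝ) : ℂ))
        (f : 𝓢'(EuclideanSpace ℝ (Fin n), ℂ)) := by
    rw [TemperedDistribution.laplacian_eq_fourierMultiplierCLM,
      ← Complex.coe_smul, ← smul_apply,
      ← TemperedDistribution.fourierMultiplierCLM_smul (by fun_prop)]
    congr 2
    ext ξ
    simp
    ring
  rw [e, eq_comm, fourierMultiplierCLM_eq_iff]
  simp only [mul_pow]
  fun_prop

theorem besselPotential_one_eq_iff {n : ℕ} (f g : L2 n) :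
    TemperedDistribution.besselPotential (EuclideanSpace ℝ (Fin n)) ℂ 1
      (f : 𝓢'(EuclideanSpace ℝ (Fin n), ℂ)) = (g : 𝓢'(EuclideanSpace ℝ (Fin n), ℂ)) ↔
      (𝓕 g : L2 n) =ᵐ[volume]
        fun ξ => (((1 + ‖ξ‖ ^ 2) ^ (1 / 2 : ℝ) : ℝ) : ℂ) * (𝓕 f : L2 n) ξ :=
  fourierMultiplierCLM_eq_iff (by fun_prop) f g

/-- For integrable `L²` functions the `L²` Fourier transform is given by the Fourier integral. -/
theorem fourier_ae_eq_fourierIntegral {n : ℕ} (f : L2 n)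
    (hf : Integrable (f : EuclideanSpace ℝ (Fin n) → ℂ)) :
    (𝓕 f : L2 n) =ᵐ[volume] 𝓕 (f : EuclideanSpace ℝ (Fin n) → ℂ) := by
  have hc : Continuous (𝓕 (f : EuclideanSpace ℝ (Fin n) → ℂ)) :=
    VectorFourier.fourierIntegral_continuous Real.continuous_fourierChar
      (by exact continuous_inner) hf
  refine ae_eq_of_integral_contDiff_smul_eq
    ((Lp.memLp (𝓕 f : L2 n)).locallyIntegrable (by norm_num)) hc.locallyIntegrable
    fun φ hφ hcs => ?_
  have hg₁ : HasCompactSupport (Complex.ofRealCLM ∘ φ) := hcs.comp_left rfl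
  have hg₂ : ContDiff ℝ (⊤ : ℕ∞) (Complex.ofRealCLM ∘ φ) := by fun_prop
  set ψ : 𝓢(EuclideanSpace ℝ (Fin n), ℂ) := hg₁.toSchwartzMap hg₂ with hψ
  have hψφ : ∀ x, ψ x = (φ x : ℂ) := fun x => by simp [hψ]
  -- Both transforms satisfy `∫ ψ f̂ = ∫ ψ̂ f`: the `L²` one through its agreement with the
  -- distributional one, the integral one by Fubini.
  have h1 : ∫ x, ψ x • (𝓕 f : L2 n) x = ∫ x, (𝓕 ψ) x • f x := by
    rw [← Lp.toTemperedDistribution_apply, ← Lp.toTemperedDistribution_apply,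
      ← Lp.fourier_toTemperedDistribution_eq, TemperedDistribution.fourier_apply]
  have h2 := VectorFourier.integral_fourierIntegral_smul_eq_flip (μ := volume) (ν := volume)
    (L := innerₗ (EuclideanSpace ℝ (Fin n))) (f := ψ) (g := f)
    Real.continuous_fourierChar continuous_inner ψ.integrable hf
  have h3 : ∫ x, (𝓕 ψ) x • f x = ∫ x, ψ x • 𝓕 (f : EuclideanSpace ℝ (Fin n) → ℂ) x := by
    rw [flip_innerₗ] at h2
    rw [SchwartzMap.fourier_coe]
    exact h2
  have h4 := h1.trans h3
  simpa [hψφ] using h4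

/-! ### Time-dependent multipliers: continuity and differentiability in `L²` -/

theorem norm_sq_eq_integral {n : ℕ} (f : L2 n) : ‖f‖ ^ 2 = ∫ ξ, ‖f ξ‖ ^ 2 := by
  have h := L2.inner_def (𝕜 := ℂ) f f
  rw [inner_self_eq_norm_sq_to_K] at h
  have h2 : ∫ ξ, (inner ℂ (f ξ) (f ξ) : ℂ) = ((∫ ξ, ‖f ξ‖ ^ 2 : ℝ) : ℂ) := by
    rw [← integral_complex_ofReal]
    refine integral_congr_ae (.of_forall fun ξ => ?_)
    simp only [inner_self_eq_norm_sq_to_K]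
    push_cast
    rfl
  rw [h2] at h
  apply Complex.ofReal_injective
  rw [← h, Complex.ofReal_pow]
  rfl

theorem integrable_norm_sq {n : ℕ} (f : L2 n) : Integrable fun ξ => ‖f ξ‖ ^ 2 :=
  (Lp.memLp f).integrable_norm_pow (by norm_num)

theorem memLp_mul_of_bounded {n : ℕ} {m : EuclideanSpace ℝ (Fin n) → ℂ} {M : ℝ}
    (hm : AEStronglyMeasurable m) (hM : ∀ᵐ ξ, ‖m ξ‖ ≤ M) (g : L2 n) :
    MemLp (fun ξ => m ξ * g ξ) 2 :=
  MemLp.of_le_mul (Lp.memLp g) (hm.mul (Lp.aestronglyMeasurable g)) (c := M) (by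
    filter_upwards [hM] with ξ h
    rw [norm_mul]
    gcongr)

/-- Dominated convergence in `L²` for products of multipliers with a fixed function. -/
theorem tendsto_of_dominated_multiplier {n : ℕ} {ι : Type*} {l : Filter ι}
    [l.IsCountablyGenerated] (g : L2 n) {F : ι → L2 n} {F₀ : L2 n}
    {m : ι → EuclideanSpace ℝ (Fin n) → ℂ} {m₀ : EuclideanSpace ℝ (Fin n) → ℂ} {M : ℝ}
    (hF : ∀ᶠ i in l, F i =ᵐ[volume] fun ξ => m i ξ * g ξ)
    (hF₀ : F₀ =ᵐ[volume] fun ξ => m₀ ξ * g ξ)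
    (hm : ∀ᶠ i in l, ∀ᵐ ξ, ‖m i ξ‖ ≤ M) (hm₀ : ∀ᵐ ξ, ‖m₀ ξ‖ ≤ M)
    (hlim : ∀ᵐ ξ, Tendsto (fun i => m i ξ) l (𝓝 (m₀ ξ))) :
    Tendsto F l (𝓝 F₀) := by
  have hdiff : ∀ᶠ i in l, (fun ξ => ‖(F i - F₀ : L2 n) ξ‖ ^ 2) =ᵐ[volume]
      fun ξ => ‖(m i ξ - m₀ ξ) * g ξ‖ ^ 2 := by
    filter_upwards [hF] with i hi
    filter_upwards [hi, hF₀, Lp.coeFn_sub (F i) F₀] with ξ h1 h2 h3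
    rw [h3, Pi.sub_apply, h1, h2, sub_mul]
  have hint : Tendsto (fun i => ∫ ξ, ‖(m i ξ - m₀ ξ) * g ξ‖ ^ 2) l 
      (𝓝 (∫ _ : EuclideanSpace ℝ (Fin n), (0 : ℝ))) := by
    refine tendsto_integral_filter_of_dominated_convergence
      (fun ξ => (M + M) ^ 2 * ‖g ξ‖ ^ 2) ?_ ?_ ((integrable_norm_sq g).const_mul _) ?_
    · filter_upwards [hdiff] with i hi
      exact (integrable_norm_sq (F i - F₀)).1.congr hi
    · filter_upwards [hm] with i hi
      filter_upwards [hi, hm₀] with ξ h1 h2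
      rw [Real.norm_of_nonneg (by positivity), norm_mul, mul_pow]
      gcongr
      exact (norm_sub_le _ _).trans (add_le_add h1 h2)
    · filter_upwards [hlim] with ξ h
      have := (((h.sub_const (m₀ ξ)).mul_const (g ξ)).norm).pow 2
      simpa using this
  rw [tendsto_iff_norm_sub_tendsto_zero]
  have h2 : Tendsto (fun i => ‖F i - F₀‖ ^ 2) l (𝓝 0) := by
    rw [integral_zero] at hint
    refine hint.congr' ?_
    filter_upwards [hdiff] with i hi
    rw [norm_sq_eq_integral, integral_congr_ae hi]
  simpa using (Real.continuous_sqrt.tendsto 0).comp h2 |>.congr fun i => by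
    simp [Real.sqrt_sq]

theorem continuousOn_of_multiplier {n : ℕ} (g : L2 n) {U : ℝ → L2 n}
    {m : ℝ → EuclideanSpace ℝ (Fin n) → ℂ}
    (hU : ∀ t, 0 ≤ t → U t =ᵐ[volume] fun ξ => m t ξ * g ξ)
    (hb : ∀ T, ∃ M, ∀ᵐ ξ, ∀ t ∈ Icc 0 T, ‖m t ξ‖ ≤ M)
    (hc : ∀ᵐ ξ, ContinuousOn (fun t => m t ξ) (Ici 0)) : ContinuousOn U (Ici 0) := by
  intro t ht
  obtain ⟨M, hM⟩ := hb (t + 1)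
  have ht' : (0 : ℝ) ≤ t := ht
  refine tendsto_of_dominated_multiplier g (m := m) (m₀ := m t) (M := M)
    (eventually_mem_nhdsWithin.mono hU) (hU t ht) ?_ ?_ ?_
  · have : ∀ᶠ s in 𝓝[Ici 0] t, s < t + 1 := nhdsWithin_le_nhds (Iio_mem_nhds (by linarith))
    filter_upwards [eventually_mem_nhdsWithin, this] with s hs hs'
    filter_upwards [hM] with ξ h
    exact h s ⟨hs, hs'.le⟩
  · filter_upwards [hM] with ξ h
    exact h t ⟨ht, by linarith⟩
  · filter_upwards [hc] with ξ h
    exact h t ht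

/-- The mean value inequality bounds the difference quotients by the bound on `m'`, so dominated
convergence applies to them. It needs `m'` along a whole interval at a fixed `ξ`, hence the null set
in `hb` precedes the time. -/
theorem hasDerivWithinAt_of_multiplier {n : ℕ} (g : L2 n) {U V : ℝ → L2 n}
    {m m' : ℝ → EuclideanSpace ℝ (Fin n) → ℂ}
    (hU : ∀ t, 0 ≤ t → U t =ᵐ[volume] fun ξ => m t ξ * g ξ)
    (hV : ∀ t, 0 ≤ t → V t =ᵐ[volume] fun ξ => m' t ξ * g ξ)
    (hb : ∀ T, ∃ M, ∀ᵐ ξ, ∀ t ∈ Icc 0 T, ‖m' t ξ‖ ≤ M)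
    (hd : ∀ᵐ ξ, ∀ t, 0 ≤ t → HasDerivWithinAt (fun t => m t ξ) (m' t ξ) (Ici 0) t)
    {t : ℝ} (ht : 0 ≤ t) : HasDerivWithinAt U (V t) (Ici 0) t := by
  obtain ⟨M, hM⟩ := hb (t + 1)
  rw [hasDerivWithinAt_iff_tendsto_slope]
  refine tendsto_of_dominated_multiplier g
    (m := fun s ξ => slope (fun t => m t ξ) t s) (m₀ := m' t) (M := M) ?_ (hV t ht) ?_ ?_ ?_
  · filter_upwards [eventually_mem_nhdsWithin] with s hs
    filter_upwards [hU s hs.1, hU t ht, Lp.coeFn_sub (U s) (U t),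
      Lp.coeFn_smul (s - t)⁻¹ (U s - U t)] with ξ h1 h2 h3 h4
    rw [slope_def_module, h4, Pi.smul_apply, h3, Pi.sub_apply, h1, h2, slope_def_module,
      ← sub_mul, smul_mul_assoc]
  · have : ∀ᶠ s in 𝓝[Ici 0 \ {t}] t, s < t + 1 :=
      nhdsWithin_le_nhds (Iio_mem_nhds (by linarith))
    filter_upwards [eventually_mem_nhdsWithin, this] with s hs hs'
    filter_upwards [hM, hd] with ξ h h'
    have := (convex_Icc (0 : ℝ) (t + 1)).norm_image_sub_le_of_norm_hasDerivWithin_le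
      (f := fun t => m t ξ) (C := M)
      (fun x hx => (h' x hx.1).mono Icc_subset_Ici_self)
      (fun x hx => h x hx) (⟨ht, by linarith⟩ : t ∈ Icc 0 (t + 1))
      (⟨hs.1, hs'.le⟩ : s ∈ Icc 0 (t + 1))
    have hst : 0 < ‖s - t‖ := norm_pos_iff.2 (sub_ne_zero.2 hs.2)
    rw [slope_def_module, norm_smul, norm_inv, inv_mul_le_iff₀ hst, mul_comm]
    exact this
  · filter_upwards [hM] with ξ h
    exact h t ⟨ht, by linarith⟩
  · filter_upwards [hd] with ξ h
    exact (hasDerivWithinAt_iff_tendsto_slope.1 (h t ht))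

/-! ### Real Fourier multipliers and the damping symbol -/

/-- Multiplication of an `L²` function by a real multiplier, and zero if the product is not in
`L²`. -/
def mulLp {n : ℕ} (k : EuclideanSpace ℝ (Fin n) → ℝ) (g : L2 n) : L2 n :=
  open scoped Classical in
  if h : MemLp (fun ξ => (k ξ : ℂ) * g ξ) 2 then h.toLp else 0

theorem coeFn_mulLp {n : ℕ} {k : EuclideanSpace ℝ (Fin n) → ℝ} (hk : Measurable k) {M : ℝ}
    (hM : ∀ᵐ ξ, |k ξ| ≤ M) (g : L2 n) : mulLp k g =ᵐ[volume] fun ξ => (k ξ : ℂ) * g ξ := by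
  have h : MemLp (fun ξ => (k ξ : ℂ) * g ξ) 2 :=
    memLp_mul_of_bounded (M := M) (Complex.measurable_ofReal.comp hk).aestronglyMeasurable
      (by simpa using hM) g
  rw [mulLp, dif_pos h]
  exact h.coeFn_toLp

theorem logSymbol_nonneg {n : ℕ} (θ : ℝ) (ξ : EuclideanSpace ℝ (Fin n)) : 0 ≤ logSymbol θ ξ := by
  refine Real.log_nonneg ?_
  have : 0 ≤ (2 * Real.pi * ‖ξ‖) ^ (2 * θ) := by positivity
  linarith

theorem logSymbol_le_rpow {n : ℕ} (θ : ℝ) (ξ : EuclideanSpace ℝ (Fin n)) :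
    logSymbol θ ξ ≤ (2 * Real.pi * ‖ξ‖) ^ (2 * θ) := by
  have : 0 ≤ (2 * Real.pi * ‖ξ‖) ^ (2 * θ) := by positivity
  have := Real.log_le_sub_one_of_pos (show 0 < 1 + (2 * Real.pi * ‖ξ‖) ^ (2 * θ) by linarith)
  rw [logSymbol]
  linarith

/-- As `2 * θ ≤ 1`, the damping has order at most one, so the bound that puts `u t` in `H¹` also
puts it in the domain of `L_θ`. -/
theorem logSymbol_le_one_add {n : ℕ} {θ : ℝ} (h0 : 0 < θ) (h1 : θ ≤ 1 / 2)
    (ξ : EuclideanSpace ℝ (Fin n)) : logSymbol θ ξ ≤ 1 + 2 * Real.pi * ‖ξ‖ := by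
  refine (logSymbol_le_rpow θ ξ).trans ?_
  have hr : 0 ≤ 2 * Real.pi * ‖ξ‖ := by positivity
  rcases le_total (2 * Real.pi * ‖ξ‖) 1 with h | h
  · have := Real.rpow_le_one hr h (show 0 ≤ 2 * θ by linarith)
    linarith
  · have := Real.rpow_le_rpow_of_exponent_le h (show 2 * θ ≤ 1 by linarith)
    rw [Real.rpow_one] at this
    linarith

theorem measurable_logSymbol {n : ℕ} (θ : ℝ) :
    Measurable (logSymbol θ : EuclideanSpace ℝ (Fin n) → ℝ) := by
  unfold logSymbol
  fun_prop

theorem measurable_freq {n : ℕ} :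
    Measurable fun ξ : EuclideanSpace ℝ (Fin n) => 2 * Real.pi * ‖ξ‖ := by fun_prop

/-- The zero frequency is discarded because `dampedKernelPrim` divides by `b ^ 2`. -/
theorem ae_freq_ne_zero {n : ℕ} (hn : 1 ≤ n) :
    ∀ᵐ ξ : EuclideanSpace ℝ (Fin n), 2 * Real.pi * ‖ξ‖ ≠ 0 := by
  have : Nonempty (Fin n) := ⟨⟨0, hn⟩⟩
  have h : ∀ᵐ ξ : EuclideanSpace ℝ (Fin n), ξ ≠ 0 := Measure.ae_ne volume 0
  filter_upwards [h] with ξ hξ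
  have := Real.pi_pos
  positivity

theorem fourier_logDamping {n : ℕ} {θ : ℝ} {f : L2 n} (hf : f ∈ (logDamping n θ).domain) :
    (𝓕 (logDamping n θ ⟨f, hf⟩) : L2 n) =ᵐ[volume]
      fun ξ => (logSymbol θ ξ : ℂ) * (𝓕 f : L2 n) ξ := by
  have h : logDamping n θ ⟨f, hf⟩ =
    𝓕⁻ (MemLp.toLp (logFourier θ f) (memLp_of_mem_logDomain hf) : L2 n) := rfl
  rw [h, FourierTransform.fourier_fourierInv_eq]
  exact MemLp.coeFn_toLp _

theorem fourier_add_ae {n : ℕ} (f g : L2 n) :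
    (𝓕 (f + g) : L2 n) =ᵐ[volume] fun ξ => (𝓕 f : L2 n) ξ + (𝓕 g : L2 n) ξ := by
  rw [FourierTransform.fourier_add]
  exact Lp.coeFn_add _ _

theorem fourier_sub_ae {n : ℕ} (f g : L2 n) :
    (𝓕 (f - g) : L2 n) =ᵐ[volume] fun ξ => (𝓕 f : L2 n) ξ - (𝓕 g : L2 n) ξ := by
  rw [show (𝓕 (f - g) : L2 n) = 𝓕 f - 𝓕 g from (Lp.fourierTransformₗᵢ _ ℂ).map_sub f g]
  exact Lp.coeFn_sub _ _

/-- The Fourier multiplier with real symbol `k`. -/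
def fourierMul {n : ℕ} (k : EuclideanSpace ℝ (Fin n) → ℝ) (f : L2 n) : L2 n :=
  𝓕⁻ (mulLp k (𝓕 f : L2 n))

theorem fourier_fourierMul {n : ℕ} {k : EuclideanSpace ℝ (Fin n) → ℝ} (hk : Measurable k) {M : ℝ}
    (hM : ∀ᵐ ξ, |k ξ| ≤ M) (f : L2 n) :
    (𝓕 (fourierMul k f) : L2 n) =ᵐ[volume] fun ξ => (k ξ : ℂ) * (𝓕 f : L2 n) ξ := by
  rw [fourierMul, FourierTransform.fourier_fourierInv_eq]
  exact coeFn_mulLp hk hM _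

theorem continuousOn_fourierMul {n : ℕ} (f : L2 n) {k : ℝ → EuclideanSpace ℝ (Fin n) → ℝ}
    (hk : ∀ t, Measurable (k t)) (hb : ∀ T, ∃ M, ∀ᵐ ξ, ∀ t ∈ Icc 0 T, |k t ξ| ≤ M)
    (hc : ∀ᵐ ξ, ContinuousOn (fun t => k t ξ) (Ici 0)) :
    ContinuousOn (fun t => fourierMul (k t) f) (Ici 0) := by
  refine (Lp.fourierTransformₗᵢ _ ℂ).symm.continuous.comp_continuousOn
    (continuousOn_of_multiplier (𝓕 f : L2 n) (m := fun t ξ => (k t ξ : ℂ)) (fun t ht => ?_) ?_ ?_)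
  · obtain ⟨M, hM⟩ := hb t
    exact coeFn_mulLp (hk t) (hM.mono fun ξ h => h t ⟨ht, le_rfl⟩) _
  · simpa using hb
  · filter_upwards [hc] with ξ h
    exact Complex.continuous_ofReal.comp_continuousOn h

theorem hasDerivWithinAt_fourierMul {n : ℕ} (f : L2 n) {k k' : ℝ → EuclideanSpace ℝ (Fin n) → ℝ}
    (hk : ∀ t, Measurable (k t)) (hk' : ∀ t, Measurable (k' t))
    (hb : ∀ T, ∃ M, ∀ᵐ ξ, ∀ t ∈ Icc 0 T, |k t ξ| ≤ M)
    (hb' : ∀ T, ∃ M, ∀ᵐ ξ, ∀ t ∈ Icc 0 T, |k' t ξ| ≤ M)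
    (hd : ∀ᵐ ξ, ∀ t, HasDerivAt (fun t => k t ξ) (k' t ξ) t) {t : ℝ} (ht : 0 ≤ t) :
    HasDerivWithinAt (fun t => fourierMul (k t) f) (fourierMul (k' t) f) (Ici 0) t := by
  have h := hasDerivWithinAt_of_multiplier (𝓕 f : L2 n) (U := fun t => mulLp (k t) (𝓕 f : L2 n))
    (V := fun t => mulLp (k' t) (𝓕 f : L2 n))
    (m := fun t ξ => (k t ξ : ℂ)) (m' := fun t ξ => (k' t ξ : ℂ))
    (fun t ht => by
      obtain ⟨M, hM⟩ := hb t
      exact coeFn_mulLp (hk t) (hM.mono fun ξ h => h t ⟨ht, le_rfl⟩) _)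
    (fun t ht => by
      obtain ⟨M, hM⟩ := hb' t
      exact coeFn_mulLp (hk' t) (hM.mono fun ξ h => h t ⟨ht, le_rfl⟩) _)
    (by simpa using hb')
    (by
      filter_upwards [hd] with ξ h t _
      exact (h t).ofReal_comp.hasDerivWithinAt) ht
  let A : L2 n →L[ℝ] L2 n :=
    ((Lp.fourierTransformₗᵢ (EuclideanSpace ℝ (Fin n)) ℂ).symm.toContinuousLinearEquiv :
      L2 n →L[ℂ] L2 n).restrictScalars ℝ
  exact A.hasFDerivAt.comp_hasDerivWithinAt t h

theorem continuousOn_of_forall_hasDerivWithinAt {n : ℕ} {u v : ℝ → L2 n}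
    (h : ∀ t ∈ Ici (0 : ℝ), HasDerivWithinAt u (v t) (Ici 0) t) : ContinuousOn u (Ici 0) :=
  fun t ht => (h t ht).continuousWithinAt

theorem integral_eq_of_hasDerivWithinAt {n : ℕ} {W u : ℝ → L2 n} (hu : ContinuousOn u (Ici 0))
    (h : ∀ t ∈ Ici (0 : ℝ), HasDerivWithinAt W (u t) (Ici 0) t) {t : ℝ} (ht : 0 ≤ t) :
    ∫ s in (0 : ℝ)..t, u s = W t - W 0 := by
  refine intervalIntegral.integral_eq_sub_of_hasDeriv_right_of_le ht
    ((continuousOn_of_forall_hasDerivWithinAt h).mono Icc_subset_Ici_self)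
    (fun s hs => (h s hs.1.le).mono fun x hx => hs.1.le.trans (le_of_lt hx)) ?_
  refine ContinuousOn.intervalIntegrable ?_
  rw [uIcc_of_le ht]
  exact hu.mono Icc_subset_Ici_self

/-! ### Existence of the mild solution -/

/-- The multiplier of the solution operator `u₁ ↦ u t`. -/
def solutionSymbol {n : ℕ} (θ t : ℝ) (ξ : EuclideanSpace ℝ (Fin n)) : ℝ :=
  dampedKernel (logSymbol θ ξ) (2 * Real.pi * ‖ξ‖) t

theorem measurable_solutionSymbol {n : ℕ} (θ t : ℝ) :
    Measurable (solutionSymbol θ t : EuclideanSpace ℝ (Fin n) → ℝ) :=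
  measurable_dampedKernel (measurable_logSymbol θ) measurable_freq t

theorem abs_solutionSymbol_le {n : ℕ} (θ : ℝ) {t : ℝ} (ht : 0 ≤ t)
    (ξ : EuclideanSpace ℝ (Fin n)) : |solutionSymbol θ t ξ| ≤ t :=
  abs_dampedKernel_le (logSymbol_nonneg θ ξ) ht

theorem one_add_freq_mul_solutionSymbol_le {n : ℕ} (θ : ℝ) {t : ℝ} (ht : 0 ≤ t)
    (ξ : EuclideanSpace ℝ (Fin n)) :
    (1 + 2 * Real.pi * ‖ξ‖) * |solutionSymbol θ t ξ| ≤ t + 1 := by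
  have h1 := abs_solutionSymbol_le θ ht ξ
  have h2 := abs_mul_dampedKernel_le (b := 2 * Real.pi * ‖ξ‖) (logSymbol_nonneg θ ξ) ht
  rw [abs_mul, abs_of_nonneg (by positivity)] at h2
  rw [solutionSymbol] at *
  linarith

/-- The solution given by its Fourier representation. -/
def fourierSolution {n : ℕ} (θ : ℝ) (u₁ : L2 n) (t : ℝ) : L2 n :=
  fourierMul (solutionSymbol θ t) u₁

theorem besselSymbol_mul_solutionSymbol_le {n : ℕ} (θ : ℝ) {t : ℝ} (ht : 0 ≤ t)
    (ξ : EuclideanSpace ℝ (Fin n)) :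
    |(1 + ‖ξ‖ ^ 2) ^ (1 / 2 : ℝ) * solutionSymbol θ t ξ| ≤ t + 1 := by
  have h : (1 + ‖ξ‖ ^ 2) ^ (1 / 2 : ℝ) ≤ 1 + 2 * Real.pi * ‖ξ‖ := by
    rw [← Real.sqrt_eq_rpow]
    refine Real.sqrt_le_iff.2 ⟨by positivity, ?_⟩
    have := Real.pi_gt_three
    have : ‖ξ‖ ≤ 2 * Real.pi * ‖ξ‖ := le_mul_of_one_le_left (norm_nonneg ξ) (by linarith)
    nlinarith [norm_nonneg ξ]
  rw [abs_mul, abs_of_nonneg (by positivity)]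
  exact (mul_le_mul_of_nonneg_right h (abs_nonneg _)).trans
    (one_add_freq_mul_solutionSymbol_le θ ht ξ)

theorem logSymbol_mul_solutionSymbol_le {n : ℕ} {θ : ℝ} (h0 : 0 < θ) (h1 : θ ≤ 1 / 2) {t : ℝ}
    (ht : 0 ≤ t) (ξ : EuclideanSpace ℝ (Fin n)) :
    |logSymbol θ ξ * solutionSymbol θ t ξ| ≤ t + 1 := by
  rw [abs_mul, abs_of_nonneg (logSymbol_nonneg θ ξ)]
  exact (mul_le_mul_of_nonneg_right (logSymbol_le_one_add h0 h1 ξ) (abs_nonneg _)).trans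
    (one_add_freq_mul_solutionSymbol_le θ ht ξ)

/-- The multipliers `G`, `G'` and `∫ G` represent `u`, `u_t` and `∫ u`. The last holds because the
`∫ G` multiplier applied to `u₁` has derivative `u` and vanishes at time zero. The equation is then
`dampedKernelDeriv_add` times `û₁`. -/
theorem isMildSolution_fourierSolution {n : ℕ} (hn : 1 ≤ n) {θ : ℝ} (h0 : 0 < θ) (h1 : θ ≤ 1 / 2)
    (u₁ : L2 n) : IsMildSolution θ 0 u₁ (fourierSolution θ u₁) := by
  have hu : ∀ t, 0 ≤ t → (𝓕 (fourierSolution θ u₁ t) : L2 n) =ᵐ[volume]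
      fun ξ => (solutionSymbol θ t ξ : ℂ) * (𝓕 u₁ : L2 n) ξ := fun t ht =>
    fourier_fourierMul (measurable_solutionSymbol θ t)
      (.of_forall fun ξ => abs_solutionSymbol_le θ ht ξ) u₁
  set kd : ℝ → EuclideanSpace ℝ (Fin n) → ℝ := fun t ξ =>
    dampedKernelDeriv (logSymbol θ ξ) (2 * Real.pi * ‖ξ‖) t with hkd
  set kp : ℝ → EuclideanSpace ℝ (Fin n) → ℝ := fun t ξ =>
    dampedKernelPrim (logSymbol θ ξ) (2 * Real.pi * ‖ξ‖) t with hkp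
  have mkd : ∀ t, Measurable (kd t) := fun t =>
    measurable_dampedKernelDeriv (measurable_logSymbol θ) measurable_freq t
  have mkp : ∀ t, Measurable (kp t) := fun t =>
    measurable_dampedKernelPrim (measurable_logSymbol θ) measurable_freq t
  have bk : ∀ T, ∃ M, ∀ᵐ ξ : EuclideanSpace ℝ (Fin n), ∀ t ∈ Icc 0 T,
      |solutionSymbol θ t ξ| ≤ M := fun T =>
    ⟨T, .of_forall fun ξ t ht => (abs_solutionSymbol_le θ ht.1 ξ).trans ht.2⟩
  have bkd : ∀ T, ∃ M, ∀ᵐ ξ : EuclideanSpace ℝ (Fin n), ∀ t ∈ Icc 0 T, |kd t ξ| ≤ M := fun T =>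
    ⟨1, .of_forall fun ξ t ht => abs_dampedKernelDeriv_le (logSymbol_nonneg θ ξ) ht.1⟩
  have bkp' : ∀ t, 0 ≤ t → ∀ᵐ ξ : EuclideanSpace ℝ (Fin n), |kp t ξ| ≤ t * t := fun t ht => by
    filter_upwards [ae_freq_ne_zero hn] with ξ hξ
    exact abs_dampedKernelPrim_le (logSymbol_nonneg θ ξ) hξ ht
  have bkp : ∀ T, ∃ M, ∀ᵐ ξ : EuclideanSpace ℝ (Fin n), ∀ t ∈ Icc 0 T, |kp t ξ| ≤ M := fun T => by
    refine ⟨T * T, ?_⟩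
    filter_upwards [ae_freq_ne_zero hn] with ξ hξ t ht
    exact (abs_dampedKernelPrim_le (logSymbol_nonneg θ ξ) hξ ht.1).trans
      (mul_self_le_mul_self ht.1 ht.2)
  have hderiv : ∀ t ∈ Ici (0 : ℝ), HasDerivWithinAt (fourierSolution θ u₁) (fourierMul (kd t) u₁)
      (Ici 0) t := fun t ht =>
    hasDerivWithinAt_fourierMul u₁ (measurable_solutionSymbol θ) mkd bk bkd
      (.of_forall fun ξ t => hasDerivAt_dampedKernel _ _ t) ht
  have hprim : ∀ t ∈ Ici (0 : ℝ), HasDerivWithinAt (fun t => fourierMul (kp t) u₁)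
      (fourierSolution θ u₁ t) (Ici 0) t := fun t ht =>
    hasDerivWithinAt_fourierMul u₁ mkp (measurable_solutionSymbol θ) bkp bk
      ((ae_freq_ne_zero hn).mono fun ξ hξ t => hasDerivAt_dampedKernelPrim _ hξ t) ht
  -- Used at `t = 0`, where the multipliers are the constants `0` and `1`.
  have fourierMul_eq : ∀ {k : EuclideanSpace ℝ (Fin n) → ℝ}, Measurable k → ∀ c : ℝ, |c| ≤ 1 →
      (∀ᵐ ξ, k ξ = c) → fourierMul k u₁ = (c : ℂ) • u₁ := fun {k} mk c hc1 hk => by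
    have h : mulLp k (𝓕 u₁ : L2 n) = (c : ℂ) • (𝓕 u₁ : L2 n) := by
      refine Lp.ext ?_
      filter_upwards [coeFn_mulLp mk (M := 1) (hk.mono fun ξ h => by rwa [h]) (𝓕 u₁ : L2 n), hk,
        Lp.coeFn_smul (c : ℂ) (𝓕 u₁ : L2 n)] with ξ h1 h2 h3
      rw [h1, h3, h2, Pi.smul_apply, smul_eq_mul]
    rw [fourierMul, h, FourierTransform.fourierInv_smul, FourierTransform.fourierInv_fourier_eq]
  have hint : ∀ t, 0 ≤ t → ∫ s in (0 : ℝ)..t, fourierSolution θ u₁ s = fourierMul (kp t) u₁ :=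
    fun t ht => by
      rw [integral_eq_of_hasDerivWithinAt (continuousOn_of_forall_hasDerivWithinAt hderiv) hprim ht,
        fourierMul_eq (mkp 0) 0 (by simp)
          (.of_forall fun ξ => by rw [hkp]; exact dampedKernelPrim_zero _ _)]
      simp
  refine ⟨⟨fun t => fourierMul (fun ξ => (1 + ‖ξ‖ ^ 2) ^ (1 / 2 : ℝ) * solutionSymbol θ t ξ) u₁,
    ?_, ?_⟩, ?_, fun t => fourierMul (kd t) u₁, ?_, hderiv, ?_, ?_⟩
  · refine continuousOn_fourierMul u₁ (fun t => Measurable.mul (by fun_prop)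
      (measurable_solutionSymbol θ t)) (fun T => ⟨T + 1, .of_forall fun ξ t ht => ?_⟩)
      (.of_forall fun ξ => ?_)
    · exact (besselSymbol_mul_solutionSymbol_le θ ht.1 ξ).trans (by linarith [ht.2])
    · exact (continuous_const.mul (continuous_iff_continuousAt.2 fun t =>
        (hasDerivAt_dampedKernel _ _ t).continuousAt)).continuousOn
  · intro t ht
    rw [besselPotential_one_eq_iff]
    filter_upwards [hu t ht, fourier_fourierMul
      (k := fun ξ => (1 + ‖ξ‖ ^ 2) ^ (1 / 2 : ℝ) * solutionSymbol θ t ξ)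
      (Measurable.mul (by fun_prop) (measurable_solutionSymbol θ t))
      (.of_forall fun ξ => besselSymbol_mul_solutionSymbol_le θ ht ξ) u₁] with ξ h1 h2
    rw [h1, h2]
    push_cast
    ring
  · rw [fourierSolution, fourierMul_eq (measurable_solutionSymbol θ 0) 0 (by simp)
      (.of_forall fun ξ => dampedKernel_zero _ _)]
    simp
  · refine continuousOn_fourierMul u₁ mkd bkd (.of_forall fun ξ => ?_)
    exact (continuous_iff_continuousAt.2 fun t =>
        (hasDerivAt_dampedKernelDeriv _ _ t).continuousAt).continuousOn
  · change fourierMul (kd 0) u₁ = u₁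
    rw [fourierMul_eq (mkd 0) 1 (by simp)
      (.of_forall fun ξ => by rw [hkd]; exact dampedKernelDeriv_zero _ _)]
    simp
  · intro t ht
    have ht' : (0 : ℝ) ≤ t := ht
    rw [sub_zero]
    have hdom : fourierSolution θ u₁ t ∈ (logDamping n θ).domain := by
      have := memLp_mul_of_bounded (m := fun ξ => ((logSymbol θ ξ * solutionSymbol θ t ξ : ℝ) : ℂ))
        (M := t + 1) (Complex.measurable_ofReal.comp ((measurable_logSymbol θ).mul
          (measurable_solutionSymbol θ t))).aestronglyMeasurable
        (.of_forall fun ξ => by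
          rw [Complex.norm_real]; exact logSymbol_mul_solutionSymbol_le h0 h1 ht' ξ) (𝓕 u₁ : L2 n)
      refine (memLp_congr_ae ?_).1 this
      filter_upwards [hu t ht] with ξ h
      rw [logFourier, h]
      push_cast
      ring
    refine ⟨hdom, ?_⟩
    rw [hint t ht, laplacian_eq_iff]
    filter_upwards [hu t ht, ae_freq_ne_zero hn, fourier_logDamping hdom,
      fourier_fourierMul (mkp t) (bkp' t ht) u₁,
      fourier_fourierMul (mkd t) (M := 1)
        (.of_forall fun ξ => abs_dampedKernelDeriv_le (logSymbol_nonneg θ ξ) ht') u₁,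
      fourier_add_ae (fourierMul (kd t) u₁ - u₁) (logDamping n θ ⟨_, hdom⟩),
      fourier_sub_ae (fourierMul (kd t) u₁) u₁] with ξ e1 hξ e2 e3 e4 e5 e6
    have key := dampedKernelDeriv_add (logSymbol θ ξ) hξ t
    have key' := congrArg (fun x : ℝ => (x : ℂ)) key
    push_cast at key'
    rw [e5, e6, e2, e1, e3, e4, solutionSymbol, hkd, hkp]
    push_cast
    linear_combination (𝓕 u₁ : L2 n) ξ * key'

/-! ### Uniqueness of the mild solution -/

/-- Multiplication by a bounded multiplier, as a bounded operator. -/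
def mulCLM {n : ℕ} (k : EuclideanSpace ℝ (Fin n) → ℝ) (hk : Measurable k) (M : ℝ)
    (hM : ∀ ξ, |k ξ| ≤ M) : L2 n →L[ℝ] L2 n :=
  LinearMap.mkContinuous
    { toFun := fun g => mulLp k g
      map_add' := fun f g => by
        refine Lp.ext ?_
        filter_upwards [coeFn_mulLp hk (.of_forall hM) f, coeFn_mulLp hk (.of_forall hM) g,
          coeFn_mulLp hk (.of_forall hM) (f + g), Lp.coeFn_add f g,
          Lp.coeFn_add (mulLp k f) (mulLp k g)] with ξ h1 h2 h3 h4 h5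
        rw [h3, h5, h4, Pi.add_apply, Pi.add_apply, h1, h2, mul_add]
      map_smul' := fun c f => by
        refine Lp.ext ?_
        filter_upwards [coeFn_mulLp hk (.of_forall hM) f,
          coeFn_mulLp hk (.of_forall hM) (c • f), Lp.coeFn_smul c f,
          Lp.coeFn_smul c (mulLp k f)] with ξ h1 h3 h4 h5
        rw [RingHom.id_apply, h3, h5, h4, Pi.smul_apply, Pi.smul_apply, h1, mul_smul_comm] }
    M fun g => Lp.norm_le_mul_norm_of_ae_le_mul (by
      filter_upwards [coeFn_mulLp hk (.of_forall hM) g] with ξ h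
      change ‖mulLp k g ξ‖ ≤ _
      rw [h, norm_mul, Complex.norm_real]
      exact mul_le_mul_of_nonneg_right (hM ξ) (norm_nonneg _))

theorem coeFn_mulCLM {n : ℕ} {k : EuclideanSpace ℝ (Fin n) → ℝ} (hk : Measurable k) {M : ℝ}
    (hM : ∀ ξ, |k ξ| ≤ M) (g : L2 n) :
    mulCLM k hk M hM g =ᵐ[volume] fun ξ => (k ξ : ℂ) * g ξ :=
  coeFn_mulLp hk (.of_forall hM) g

/-- A linear second order equation with bounded operators as coefficients, written as
`S' = U`, `U' = -A U - B S`, has only the zero solution with zero initial values. -/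
theorem eq_zero_of_linear_ode {E : Type*} [NormedAddCommGroup E] [NormedSpace ℝ E]
    (A B : E →L[ℝ] E) {S U : ℝ → E}
    (hS : ∀ t ∈ Ici (0 : ℝ), HasDerivWithinAt S (U t) (Ici 0) t)
    (hU : ∀ t ∈ Ici (0 : ℝ), HasDerivWithinAt U (-A (U t) - B (S t)) (Ici 0) t)
    (hS0 : S 0 = 0) (hU0 : U 0 = 0) {t : ℝ} (ht : 0 ≤ t) : U t = 0 := by
  let L : E × E →L[ℝ] E × E :=
    (ContinuousLinearMap.snd ℝ E E).prod
      (-A ∘L ContinuousLinearMap.snd ℝ E E - B ∘L ContinuousLinearMap.fst ℝ E E)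
  have hd : ∀ t ∈ Ici (0 : ℝ), HasDerivWithinAt (fun t => (S t, U t)) (L (S t, U t)) (Ici 0) t :=
    fun t ht => (hS t ht).prodMk (hU t ht)
  have := ODE_solution_unique (v := fun _ => L) (fun _ => L.lipschitz)
    (f := fun t => (S t, U t)) (g := fun _ => 0) (a := 0) (b := t)
    (fun s hs => ((hd s hs.1).continuousWithinAt).mono Icc_subset_Ici_self)
    (fun s hs => (hd s hs.1).mono (Ici_subset_Ici.2 hs.1)) continuousOn_const
    (fun s _ => by simpa using hasDerivWithinAt_const s (Ici s) (0 : E × E)) (by simp [hS0, hU0])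
    (right_mem_Icc.2 ht)
  exact (Prod.ext_iff.1 this).2

theorem IsMildSolution.continuousOn {n : ℕ} {θ : ℝ} {u₀ u₁ : L2 n} {u : ℝ → L2 n}
    (h : IsMildSolution θ u₀ u₁ u) : ContinuousOn u (Ici 0) := by
  obtain ⟨v, -, hv, -⟩ := h.equation
  exact continuousOn_of_forall_hasDerivWithinAt hv

theorem hasDerivWithinAt_integral {n : ℕ} {u : ℝ → L2 n} (hu : ContinuousOn u (Ici 0)) {t : ℝ}
    (ht : t ∈ Ici (0 : ℝ)) :
    HasDerivWithinAt (fun t => ∫ s in (0 : ℝ)..t, u s) (u t) (Ici 0) t := by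
  have hint : ∀ T ∈ Ici (0 : ℝ), IntervalIntegrable u volume 0 T := fun T hT => by
    refine ContinuousOn.intervalIntegrable ?_
    rw [uIcc_of_le hT]
    exact hu.mono Icc_subset_Ici_self
  have hmem : Icc 0 (t + 1) ∈ 𝓝[Ici 0] t := by
    rw [← Ici_inter_Iic]
    exact inter_mem self_mem_nhdsWithin (nhdsWithin_le_nhds (Iic_mem_nhds (by linarith)))
  have ht' : t ∈ Icc 0 (t + 1) := ⟨ht, by linarith⟩
  -- Needed for the `FTCFilter` instance of `𝓝[Icc 0 (t + 1)] t`: `u` is continuous only on `[0,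
  -- ∞)`, so the derivative at `0` is one-sided.
  have : Fact (t ∈ Icc 0 (t + 1)) := ⟨ht'⟩
  have hc : ContinuousOn u (Icc 0 (t + 1)) := hu.mono Icc_subset_Ici_self
  have := intervalIntegral.integral_hasDerivWithinAt_right (s := Icc 0 (t + 1))
    (t := Icc 0 (t + 1)) (hint t ht)
    (hc.stronglyMeasurableAtFilter_nhdsWithin measurableSet_Icc t) (hc t ht')
  exact this.mono_of_mem_nhdsWithin hmem

theorem IsMildSolution.fourier_equation {n : ℕ} {θ : ℝ} {u₁ : L2 n} {u : ℝ → L2 n}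
    (h : IsMildSolution θ 0 u₁ u) :
    ∃ v : ℝ → L2 n, (∀ t ∈ Ici (0 : ℝ), HasDerivWithinAt u (v t) (Ici 0) t) ∧
      ∀ t ∈ Ici (0 : ℝ), ∀ᵐ ξ, (𝓕 (v t) : L2 n) ξ = (𝓕 u₁ : L2 n) ξ -
        (logSymbol θ ξ : ℂ) * (𝓕 (u t) : L2 n) ξ -
        (((2 * Real.pi * ‖ξ‖) ^ 2 : ℝ) : ℂ) * (𝓕 (∫ s in (0 : ℝ)..t, u s) : L2 n) ξ := by
  obtain ⟨v, -, hv, -, heq⟩ := h.equation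
  refine ⟨v, hv, fun t ht => ?_⟩
  obtain ⟨hdom, e⟩ := heq t ht
  rw [laplacian_eq_iff] at e
  filter_upwards [e, fourier_add_ae (v t - u₁) (logDamping n θ ⟨_, hdom⟩),
    fourier_sub_ae (v t) u₁, fourier_logDamping hdom] with ξ h1 h2 h3 h4
  rw [h2, h3, h4, sub_zero] at h1
  linear_combination h1

/-- Mild solutions are unique: after a frequency cut-off the difference of two of them solves a
linear ODE with bounded coefficients. -/
theorem IsMildSolution.unique {n : ℕ} {θ : ℝ} (h0 : 0 < θ) (h1 : θ ≤ 1 / 2) {u₁ : L2 n}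
    {u w : ℝ → L2 n} (hu : IsMildSolution θ 0 u₁ u) (hw : IsMildSolution θ 0 u₁ w) :
    EqOn w u (Ici 0) := by
  let K : ℝ → Set (EuclideanSpace ℝ (Fin n)) := fun R => Metric.closedBall 0 R
  have mR : ∀ {k : EuclideanSpace ℝ (Fin n) → ℝ}, Measurable k → ∀ R,
      Measurable ((K R).indicator k) :=
    fun hk R => hk.indicator measurableSet_closedBall
  have bR : ∀ {k : EuclideanSpace ℝ (Fin n) → ℝ} {M : ℝ} {R : ℝ}, (∀ ξ, 0 ≤ k ξ) →
      (∀ ξ, ‖ξ‖ ≤ R → k ξ ≤ M) → 0 ≤ M → ∀ ξ, |(K R).indicator k ξ| ≤ M :=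
    fun {k M R} h0 hk hM ξ => by
      by_cases h : ξ ∈ K R
      · rw [indicator_of_mem h, abs_of_nonneg (h0 ξ)]
        exact hk ξ (by simpa [K] using h)
      · rw [indicator_of_notMem h, abs_zero]
        exact hM
  obtain ⟨v, hv, ev⟩ := hu.fourier_equation
  obtain ⟨v', hv', ev'⟩ := hw.fourier_equation
  let F : L2 n →L[ℝ] L2 n :=
    ((Lp.fourierTransformₗᵢ (EuclideanSpace ℝ (Fin n)) ℂ).toContinuousLinearEquiv :
      L2 n →L[ℂ] L2 n).restrictScalars ℝ
  have hF : ∀ f, F f = (𝓕 f : L2 n) := fun _ => rfl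
  -- In terms of the time integral `S` of the difference, subtracting the two mild equations gives
  -- `S'' = -a S' - b² S` in frequency, with zero initial values.
  let S : ℝ → L2 n := fun t => (∫ s in (0 : ℝ)..t, u s) - ∫ s in (0 : ℝ)..t, w s
  have hS : ∀ t ∈ Ici (0 : ℝ), HasDerivWithinAt S (u t - w t) (Ici 0) t := fun t ht =>
    (hasDerivWithinAt_integral hu.continuousOn ht).sub
      (hasDerivWithinAt_integral hw.continuousOn ht)
  intro t ht
  -- Natural radii, so that only countably many null sets have to be united.
  have key : ∀ R : ℕ, ∀ᵐ ξ, ξ ∈ K R → (𝓕 (u t - w t) : L2 n) ξ = 0 := fun R => by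
    have hR : (0 : ℝ) ≤ R := R.cast_nonneg
    have mχ := mR (k := fun _ => 1) measurable_const R
    have mα := mR (measurable_logSymbol (n := n) θ) R
    have mβ := mR (measurable_freq (n := n).pow_const 2) R
    have bχ := bR (k := fun _ => 1) (M := 1) (R := R) (fun _ => zero_le_one)
      (fun _ _ => le_rfl) zero_le_one
    have bα := bR (R := R) (M := 1 + 2 * Real.pi * R) (logSymbol_nonneg θ)
      (fun ξ h => (logSymbol_le_one_add h0 h1 ξ).trans (by gcongr)) (by positivity)
    have bβ := bR (k := fun ξ => (2 * Real.pi * ‖ξ‖) ^ 2) (R := R) (M := (2 * Real.pi * R) ^ 2)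
      (fun ξ => by positivity) (fun ξ h => by gcongr) (by positivity)
    let P := mulCLM _ mχ _ bχ
    let A := mulCLM _ mα _ bα
    let B := mulCLM _ mβ _ bβ
    let T : L2 n →L[ℝ] L2 n := P ∘L F
    have hP : ∀ f : L2 n, P f =ᵐ[volume] _ := coeFn_mulCLM mχ bχ
    have hA : ∀ f : L2 n, A f =ᵐ[volume] _ := coeFn_mulCLM mα bα
    have hB : ∀ f : L2 n, B f =ᵐ[volume] _ := coeFn_mulCLM mβ bβ
    have hT : ∀ f : L2 n, T f = P (𝓕 f : L2 n) := fun _ => rfl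
    have hTS : ∀ t ∈ Ici (0 : ℝ), HasDerivWithinAt (fun t => T (S t)) (T (u t - w t)) (Ici 0) t :=
      fun t ht => T.hasFDerivAt.comp_hasDerivWithinAt t (hS t ht)
    have hTU : ∀ t ∈ Ici (0 : ℝ), HasDerivWithinAt (fun t => T (u t - w t))
        (-A (T (u t - w t)) - B (T (S t))) (Ici 0) t := fun t ht => by
      have h := T.hasFDerivAt.comp_hasDerivWithinAt t ((hv t ht).sub (hv' t ht))
      refine h.congr_deriv (Lp.ext ?_)
      filter_upwards [ev t ht, ev' t ht, hP (𝓕 (v t - v' t) : L2 n), hP (𝓕 (u t - w t) : L2 n),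
        hP (𝓕 (S t) : L2 n), hA (T (u t - w t)), hB (T (S t)), fourier_sub_ae (v t) (v' t),
        fourier_sub_ae (u t) (w t),
        fourier_sub_ae (∫ s in (0 : ℝ)..t, u s) (∫ s in (0 : ℝ)..t, w s),
        Lp.coeFn_sub (-A (T (u t - w t))) (B (T (S t))), Lp.coeFn_neg (A (T (u t - w t)))]
        with ξ e1 e2 e3 e4 e5 e6 e7 e8 e9 e10 e11 e12
      rw [hT, e3, e8, e1, e2, e11, Pi.sub_apply, e12, Pi.neg_apply, e6, e7, hT, hT, e4, e5, e9, e10]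
      by_cases hξ : ξ ∈ K R
      · simp only [indicator_of_mem hξ]
        push_cast
        ring
      · simp only [indicator_of_notMem hξ]
        push_cast
        ring
    have hz := eq_zero_of_linear_ode A B hTS hTU (by simp [S]) (by simp [hu.initial, hw.initial])
      (t := t) ht
    rw [hT] at hz
    filter_upwards [hP (𝓕 (u t - w t) : L2 n), Lp.coeFn_zero ℂ 2 volume] with ξ e1 e2 hξ
    rw [hz, e2, indicator_of_mem hξ] at e1
    simpa using e1.symm
  have hzero : (𝓕 (u t - w t) : L2 n) = 0 := by
    refine Lp.ext ?_
    filter_upwards [ae_all_iff.2 key, Lp.coeFn_zero ℂ 2 volume] with ξ h h2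
    obtain ⟨R, hR⟩ := exists_nat_ge ‖ξ‖
    rw [h R (by simpa [K] using hR), h2]
    rfl
  have := congrArg norm hzero
  rw [Lp.norm_fourier_eq, norm_zero, norm_sub_eq_zero_iff] at this
  exact this.symm

/-! ### The oscillator with logarithmic damping: low and high frequencies -/

theorem half_le_log_one_add {x : ℝ} (h0 : 0 ≤ x) (h1 : x ≤ 1) : x / 2 ≤ Real.log (1 + x) := by
  have h := Real.one_sub_inv_le_log_of_pos (show 0 < 1 + x by linarith)
  have e : 1 - (1 + x)⁻¹ = x / (1 + x) := by field_simp; ring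
  rw [e] at h
  refine le_trans ?_ h
  gcongr
  linarith

/-- Thus `r ^ (2 - 4 * θ)` is the ratio of `b²` to the square of the leading term of the damping.
Its size decides between the overdamped low frequencies and the rest. -/
theorem rpow_split_sq {θ r : ℝ} (hr : 0 < r) :
    r ^ 2 = r ^ (2 - 4 * θ) * (r ^ (2 * θ)) ^ 2 := by
  rw [← Real.rpow_natCast (r ^ (2 * θ)) 2, ← Real.rpow_mul hr.le, ← Real.rpow_add hr,
    ← Real.rpow_natCast r 2]
  congr 1
  push_cast
  ring

theorem rpow_div_rpow {θ r : ℝ} (hr : 0 < r) : r ^ 2 / r ^ (2 * θ) = r ^ (2 - 2 * θ) := by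
  rw [← Real.rpow_natCast r 2, ← Real.rpow_sub hr]
  norm_num

theorem half_rpow_le_log {θ r : ℝ} (h0 : 0 < θ) (h1 : θ < 1 / 2) (hr : 0 < r)
    (hs : r ^ (2 - 4 * θ) ≤ 3 / 64) :
    r ^ (2 * θ) / 2 ≤ Real.log (1 + r ^ (2 * θ)) := by
  have hr1 : r ≤ 1 := by
    by_contra! h
    have := Real.one_le_rpow h.le (show 0 ≤ 2 - 4 * θ by linarith)
    linarith
  exact half_le_log_one_add (by positivity) (Real.rpow_le_one hr.le hr1 (by linarith))

/-- The threshold `3/64` is `3/16` divided by the `4` lost in squaring `r ^ (2 * θ) / 2 ≤ a`. -/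
theorem sq_le_log_sq {θ r : ℝ} (h0 : 0 < θ) (h1 : θ < 1 / 2) (hr : 0 < r)
    (hs : r ^ (2 - 4 * θ) ≤ 3 / 64) :
    r ^ 2 ≤ 3 / 16 * Real.log (1 + r ^ (2 * θ)) ^ 2 := by
  have h := half_rpow_le_log h0 h1 hr hs
  have hp : 0 < r ^ (2 * θ) := by positivity
  calc r ^ 2 ≤ 3 / 64 * (r ^ (2 * θ)) ^ 2 := by
        rw [rpow_split_sq (θ := θ) hr]; gcongr
    _ = 3 / 16 * (r ^ (2 * θ) / 2) ^ 2 := by ring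
    _ ≤ _ := by gcongr

/-- With `a` between `r ^ (2θ) / 2` and `r ^ (2θ)`, the rate `b² / a` is at least `r ^ (2 - 2θ)` and
the amplitude `2 / a` at most `4 r ^ (-2θ)`, whose square gives `16`. -/
theorem dampedKernel_sq_le_of_small {θ r : ℝ} (h0 : 0 < θ) (h1 : θ < 1 / 2) (hr : 0 < r)
    (hs : r ^ (2 - 4 * θ) ≤ 3 / 64) {t : ℝ} (ht : 0 ≤ t) :
    dampedKernel (Real.log (1 + r ^ (2 * θ))) r t ^ 2 ≤
      16 * (Real.exp (-(r ^ (2 - 2 * θ) * t)) * r ^ (-(4 * θ))) := by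
  have h := half_rpow_le_log h0 h1 hr hs
  have hp : 0 < r ^ (2 * θ) := by positivity
  have hle : Real.log (1 + r ^ (2 * θ)) ≤ r ^ (2 * θ) := by
    have := Real.log_le_sub_one_of_pos (show 0 < 1 + r ^ (2 * θ) by linarith)
    linarith
  have hsq := sq_le_log_sq h0 h1 hr hs
  have hl : 0 < Real.log (1 + r ^ (2 * θ)) := by linarith
  have hk := abs_dampedKernel_le_of_overdamped hl hsq ht
  set a := Real.log (1 + r ^ (2 * θ))
  have hk2 : |dampedKernel a r t| ≤ 2 / (r ^ (2 * θ) / 2) * Real.exp (-(r ^ (2 - 2 * θ) * t)) := by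
    refine hk.trans ?_
    rw [← rpow_div_rpow hr]
    gcongr
  have e : r ^ (-(4 * θ)) = ((r ^ (2 * θ)) ^ 2)⁻¹ := by
    rw [← Real.rpow_natCast (r ^ (2 * θ)) 2, ← Real.rpow_mul hr.le, Real.rpow_neg hr.le]
    congr 2
    push_cast
    ring
  rw [← sq_abs, e]
  calc _ ≤ (2 / (r ^ (2 * θ) / 2) * Real.exp (-(r ^ (2 - 2 * θ) * t))) ^ 2 := by gcongr
    _ = 16 * (Real.exp (-(r ^ (2 - 2 * θ) * t)) ^ 2 * ((r ^ (2 * θ)) ^ 2)⁻¹) := by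
        field_simp; norm_num
    _ ≤ _ := by
        gcongr
        exact pow_le_of_le_one (Real.exp_pos _).le
          (Real.exp_le_one_iff.2 (neg_nonpos.2 (by positivity))) two_ne_zero

theorem le_dampedKernel_of_small {θ r : ℝ} (h0 : 0 < θ) (h1 : θ < 1 / 2) (hr : 0 < r)
    (hs : r ^ (2 - 4 * θ) ≤ 3 / 64) {t : ℝ} (ht : 4 ≤ r ^ (2 * θ) * t) :
    Real.exp (-(4 * r ^ (2 - 2 * θ) * t)) / (2 * r ^ (2 * θ)) ≤
      dampedKernel (Real.log (1 + r ^ (2 * θ))) r t := by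
  have h := half_rpow_le_log h0 h1 hr hs
  have hp : 0 < r ^ (2 * θ) := by positivity
  have ht0 : 0 < t := pos_of_mul_pos_right (by linarith) hp.le
  have hle : Real.log (1 + r ^ (2 * θ)) ≤ r ^ (2 * θ) := by
    have := Real.log_le_sub_one_of_pos (show 0 < 1 + r ^ (2 * θ) by linarith)
    linarith
  have hsq := sq_le_log_sq h0 h1 hr hs
  have hl : 0 < Real.log (1 + r ^ (2 * θ)) := by linarith
  have hk := le_dampedKernel_of_overdamped (t := t) hl hsq (by nlinarith)
  set a := Real.log (1 + r ^ (2 * θ))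
  refine le_trans ?_ hk
  have : 2 * r ^ 2 / a ≤ 4 * r ^ (2 - 2 * θ) := by
    rw [← rpow_div_rpow hr]
    calc 2 * r ^ 2 / a ≤ 2 * r ^ 2 / (r ^ (2 * θ) / 2) := by gcongr
      _ = _ := by field_simp; norm_num
  have h3 : 2 * r ^ 2 / a * t ≤ 4 * r ^ (2 - 2 * θ) * t := by gcongr
  have h4 : Real.exp (-(4 * r ^ (2 - 2 * θ) * t)) ≤ Real.exp (-(2 * r ^ 2 / a * t)) :=
    Real.exp_le_exp.2 (neg_le_neg h3)
  gcongr

/-- Logarithmic damping turns exponential decay in `a t` into a power of `1 + r` whose order grows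
with `t`; this comparison supplies the power. -/
theorem two_mul_log_le_log_one_add_rpow {θ r : ℝ} (h0 : 0 < θ) (hr : 0 ≤ r) :
    2 * θ * Real.log ((1 + r) / 2) ≤ Real.log (1 + r ^ (2 * θ)) := by
  rw [← Real.log_rpow (by linarith)]
  refine Real.log_le_log (by positivity) ?_
  have hp : 0 ≤ r ^ (2 * θ) := by positivity
  rcases le_total r 1 with h | h
  · have := Real.rpow_le_one (show 0 ≤ (1 + r) / 2 by linarith) (by linarith)
      (show 0 ≤ 2 * θ by linarith)
    linarith
  · have := Real.rpow_le_rpow (show 0 ≤ (1 + r) / 2 by linarith) (show (1 + r) / 2 ≤ r by linarith)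
      (show 0 ≤ 2 * θ by linarith)
    linarith

/-- Away from the zero frequency the kernel decays exponentially in time, and at a fixed large time
faster than any given power of the frequency. -/
theorem exists_dampedKernel_sq_le_of_large {θ : ℝ} (h0 : 0 < θ) (h1 : θ < 1 / 2) {N : ℝ}
    (hN : 0 ≤ N) : ∃ δ > (0 : ℝ), ∃ T > (0 : ℝ), ∀ t ≥ T, ∀ r > 0, 3 / 64 ≤ r ^ (2 - 4 * θ) →
      dampedKernel (Real.log (1 + r ^ (2 * θ))) r t ^ 2 ≤
        2 ^ N * (t ^ 2 * Real.exp (-(δ * t))) * (1 + r) ^ (-N) := by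
  set r₀ : ℝ := (3 / 64) ^ (2 - 4 * θ)⁻¹ with hr₀
  have hr₀pos : 0 < r₀ := by positivity
  set l₀ := Real.log (1 + r₀ ^ (2 * θ)) with hl₀
  have hl₀pos : 0 < l₀ := Real.log_pos (by
    have : 0 < r₀ ^ (2 * θ) := by positivity
    linarith)
  -- From this time on `3/64 * t ≥ N / (2θ)`, so `exp (-(3/64) a t)` beats the power `N`; the `+ 1`
  -- only keeps the time positive. `l₀` is the damping at the threshold frequency.
  refine ⟨3 / 64 * l₀, by positivity, 64 / 3 * (N / (2 * θ)) + 1, by positivity,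
    fun t ht r hr hs => ?_⟩
  have hNθ : 0 ≤ N / (2 * θ) := by positivity
  have ht0 : 0 ≤ t := by linarith
  have hrr : r₀ ≤ r := by
    have := Real.rpow_le_rpow (by norm_num) hs
      (show 0 ≤ (2 - 4 * θ)⁻¹ from inv_nonneg.2 (by linarith))
    rwa [← Real.rpow_mul hr.le, mul_inv_cancel₀ (by linarith), Real.rpow_one] at this
  have hp : 0 < r ^ (2 * θ) := by positivity
  have hll : l₀ ≤ Real.log (1 + r ^ (2 * θ)) := by
    refine Real.log_le_log (by positivity) ?_
    gcongr
  have hle : Real.log (1 + r ^ (2 * θ)) ≤ r ^ (2 * θ) := by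
    have := Real.log_le_sub_one_of_pos (show 0 < 1 + r ^ (2 * θ) by linarith)
    linarith
  have hlog := two_mul_log_le_log_one_add_rpow h0 hr.le
  set a := Real.log (1 + r ^ (2 * θ))
  have ha : 0 < a := by linarith
  have hb : 3 / 64 * a ^ 2 ≤ r ^ 2 := by
    rw [rpow_split_sq (θ := θ) hr]
    gcongr
  have hk := abs_dampedKernel_le_exp ha.le (by norm_num) hb ht0
  have hpow : Real.exp (-(3 / 64 * a * t)) ≤ 2 ^ N * (1 + r) ^ (-N) := by
    have e : (2 : ℝ) ^ N * (1 + r) ^ (-N) = ((1 + r) / 2) ^ (-N) := by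
      rw [Real.div_rpow (by linarith) (by norm_num), Real.rpow_neg (show (0 : ℝ) ≤ 2 by norm_num)]
      field_simp
    rw [e, Real.rpow_def_of_pos (by linarith)]
    refine Real.exp_le_exp.2 ?_
    have h5 : N / (2 * θ) * (2 * θ * Real.log ((1 + r) / 2)) ≤ N / (2 * θ) * a := by gcongr
    have h6 : N / (2 * θ) * (2 * θ * Real.log ((1 + r) / 2)) = N * Real.log ((1 + r) / 2) := by
      field_simp
    have h7 : N / (2 * θ) * a ≤ 3 / 64 * t * a := by gcongr; linarith
    linarith
  have hexp : Real.exp (-(3 / 64 * a * t)) ≤ Real.exp (-(3 / 64 * l₀ * t)) :=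
    Real.exp_le_exp.2 (by gcongr)
  rw [← sq_abs]
  calc _ ≤ (t * Real.exp (-(3 / 64 * a * t))) ^ 2 := by gcongr
    -- Squaring yields two exponentials: one is spent on decay in time, the other on decay in
    -- frequency.
    _ = t ^ 2 * (Real.exp (-(3 / 64 * a * t)) * Real.exp (-(3 / 64 * a * t))) := by ring
    _ ≤ t ^ 2 * (Real.exp (-(3 / 64 * l₀ * t)) * (2 ^ N * (1 + r) ^ (-N))) := by gcongr
    _ = _ := by ring

/-! ### Scaling integrals and the upper bound -/

/-- The profile `exp (-|x|^p) |x|^(-q)` is integrable for `q < n`. -/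
theorem integrable_exp_neg_rpow_mul_rpow {n : ℕ} (hn : 1 ≤ n) {p q : ℝ} (hp : 0 < p) (hq : q < n) :
    Integrable fun ξ : EuclideanSpace ℝ (Fin n) => Real.exp (-‖ξ‖ ^ p) * ‖ξ‖ ^ (-q) := by
  have : Nonempty (Fin n) := ⟨⟨0, hn⟩⟩
  refine (integrable_fun_norm_addHaar (volume : Measure (EuclideanSpace ℝ (Fin n)))
    (f := fun y => Real.exp (-y ^ p) * y ^ (-q))).2 ?_
  refine (integrableOn_rpow_mul_exp_neg_rpow (p := p) (s := n - 1 - q) (by linarith) hp).congr_fun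
    (fun y hy => ?_) measurableSet_Ioi
  have hy' : 0 < y := hy
  simp only [finrank_euclideanSpace_fin, smul_eq_mul]
  rw [show (n : ℝ) - 1 - q = ((n - 1 : ℕ) : ℝ) + -q by push_cast [hn]; ring, Real.rpow_add hy',
    Real.rpow_natCast]
  ring

theorem exp_mul_rpow_eq_scaled {E : Type*} [NormedAddCommGroup E] [NormedSpace ℝ E] {p q t : ℝ}
    (hp : 0 < p) (ht : 0 < t) (ξ : E) :
    Real.exp (-(‖ξ‖ ^ p * t)) * ‖ξ‖ ^ (-q) =
      t ^ (q / p) * (Real.exp (-‖t ^ p⁻¹ • ξ‖ ^ p) * ‖t ^ p⁻¹ • ξ‖ ^ (-q)) := by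
  have hR : 0 < t ^ p⁻¹ := by positivity
  rw [norm_smul, Real.norm_of_nonneg hR.le, Real.mul_rpow hR.le (norm_nonneg _),
    Real.mul_rpow hR.le (norm_nonneg _), ← Real.rpow_mul ht.le, ← Real.rpow_mul ht.le,
    inv_mul_cancel₀ hp.ne', Real.rpow_one, mul_comm t]
  have : t ^ (q / p) * t ^ (p⁻¹ * -q) = 1 := by
    rw [← Real.rpow_add ht, show q / p + p⁻¹ * -q = 0 by field_simp; ring, Real.rpow_zero]
  linear_combination (-(Real.exp (-(‖ξ‖ ^ p * t)) * ‖ξ‖ ^ (-q))) * this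

theorem integrable_exp_mul_rpow {n : ℕ} (hn : 1 ≤ n) {p q t : ℝ} (hp : 0 < p) (hq : q < n)
    (ht : 0 < t) :
    Integrable fun ξ : EuclideanSpace ℝ (Fin n) => Real.exp (-(‖ξ‖ ^ p * t)) * ‖ξ‖ ^ (-q) := by
  simp only [exp_mul_rpow_eq_scaled hp ht]
  exact ((integrable_exp_neg_rpow_mul_rpow hn hp hq).comp_smul
    (Real.rpow_pos_of_pos ht p⁻¹).ne').const_mul _

theorem integral_exp_mul_rpow {n : ℕ} {p q t : ℝ} (hp : 0 < p) (ht : 0 < t) :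
    ∫ ξ : EuclideanSpace ℝ (Fin n), Real.exp (-(‖ξ‖ ^ p * t)) * ‖ξ‖ ^ (-q) =
      t ^ (-((n - q) / p)) *
        ∫ ξ : EuclideanSpace ℝ (Fin n), Real.exp (-‖ξ‖ ^ p) * ‖ξ‖ ^ (-q) := by
  have hR : 0 < t ^ p⁻¹ := by positivity
  simp only [exp_mul_rpow_eq_scaled hp ht]
  rw [integral_const_mul, Measure.integral_comp_smul_of_nonneg volume
    (fun ξ : EuclideanSpace ℝ (Fin n) => Real.exp (-‖ξ‖ ^ p) * ‖ξ‖ ^ (-q)) _ (hR := hR.le),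
    finrank_euclideanSpace_fin, smul_eq_mul, ← mul_assoc]
  congr 1
  rw [← Real.rpow_natCast, ← Real.rpow_mul ht.le, ← Real.rpow_neg ht.le, ← Real.rpow_add ht]
  congr 1
  field_simp
  ring

theorem norm_fourierIntegral_le {n : ℕ} (f : EuclideanSpace ℝ (Fin n) → ℂ)
    (ξ : EuclideanSpace ℝ (Fin n)) : ‖𝓕 f ξ‖ ≤ ∫ x, ‖f x‖ :=
  VectorFourier.norm_fourierIntegral_le_integral_norm _ _ _ f ξ

theorem integral_norm_le_weightedL1Norm {n : ℕ} {γ : ℝ} {f : EuclideanSpace ℝ (Fin n) → ℂ}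
    (hf : MemWeightedL1 γ f) : ∫ x, ‖f x‖ ≤ weightedL1Norm γ f := by
  refine integral_mono hf.1.norm hf.2 fun x => ?_
  have : 0 ≤ ‖x‖ ^ γ := by positivity
  exact le_mul_of_one_le_left (norm_nonneg _) (by linarith)

theorem norm_sq_fourierSolution_ae {n : ℕ} {θ t : ℝ} (ht : 0 ≤ t) (u₁ : L2 n) :
    (fun ξ => ‖(𝓕 (fourierSolution θ u₁ t) : L2 n) ξ‖ ^ 2) =ᵐ[volume]
      fun ξ => solutionSymbol θ t ξ ^ 2 * ‖(𝓕 u₁ : L2 n) ξ‖ ^ 2 := by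
  filter_upwards [fourier_fourierMul (measurable_solutionSymbol θ t)
      (.of_forall fun ξ => abs_solutionSymbol_le θ ht ξ) u₁] with ξ h
  rw [fourierSolution, h, norm_mul, mul_pow, Complex.norm_real, Real.norm_eq_abs, sq_abs]

theorem norm_sq_fourierSolution {n : ℕ} {θ t : ℝ} (ht : 0 ≤ t) (u₁ : L2 n) :
    ‖fourierSolution θ u₁ t‖ ^ 2 = ∫ ξ, solutionSymbol θ t ξ ^ 2 * ‖(𝓕 u₁ : L2 n) ξ‖ ^ 2 := by
  rw [← Lp.norm_fourier_eq, norm_sq_eq_integral, integral_congr_ae (norm_sq_fourierSolution_ae ht _)]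

theorem integrable_sq_fourierSolution {n : ℕ} {θ t : ℝ} (ht : 0 ≤ t) (u₁ : L2 n) :
    Integrable fun ξ => solutionSymbol θ t ξ ^ 2 * ‖(𝓕 u₁ : L2 n) ξ‖ ^ 2 :=
  (integrable_norm_sq _).congr (norm_sq_fourierSolution_ae ht u₁)

/-- The pointwise bound of the solution operator on the frequency side: the diffusive low
frequencies and the exponentially damped rest. -/
theorem exists_solutionSymbol_sq_le {n : ℕ} {θ : ℝ} (h0 : 0 < θ) (h1 : θ < 1 / 2) :
    ∃ δ > (0 : ℝ), ∃ T > (0 : ℝ), ∀ t ≥ T, ∀ ξ : EuclideanSpace ℝ (Fin n), ξ ≠ 0 →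
      solutionSymbol θ t ξ ^ 2 ≤
        16 * (Real.exp (-(‖ξ‖ ^ (2 - 2 * θ) * t)) * ‖ξ‖ ^ (-(4 * θ))) +
          2 ^ (n + 1 : ℝ) * (t ^ 2 * Real.exp (-(δ * t))) * (1 + ‖ξ‖) ^ (-(n + 1 : ℝ)) := by
  -- The order `n + 1` makes `(1 + ‖ξ‖) ^ (-(n + 1))` integrable.
  obtain ⟨δ, hδ, T, hT, h⟩ := exists_dampedKernel_sq_le_of_large h0 h1
    (show (0 : ℝ) ≤ (n + 1 : ℝ) by positivity)
  refine ⟨δ, hδ, T, hT, fun t ht ξ hξ => ?_⟩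
  have hn : 0 < ‖ξ‖ := norm_pos_iff.2 hξ
  have hle : ‖ξ‖ ≤ 2 * Real.pi * ‖ξ‖ :=
    le_mul_of_one_le_left hn.le (by linarith [Real.pi_gt_three])
  have hr : 0 < 2 * Real.pi * ‖ξ‖ := by linarith
  have ht0 : 0 < t := by linarith
  rw [solutionSymbol, logSymbol]
  rcases le_total ((2 * Real.pi * ‖ξ‖) ^ (2 - 4 * θ)) (3 / 64) with hs | hs
  · refine (dampedKernel_sq_le_of_small h0 h1 hr hs ht0.le).trans ?_
    refine le_add_of_le_of_nonneg ?_ (by positivity)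
    have e1 : Real.exp (-((2 * Real.pi * ‖ξ‖) ^ (2 - 2 * θ) * t)) ≤
        Real.exp (-(‖ξ‖ ^ (2 - 2 * θ) * t)) := by
      refine Real.exp_le_exp.2 (neg_le_neg (mul_le_mul_of_nonneg_right ?_ ht0.le))
      exact Real.rpow_le_rpow hn.le hle (by linarith)
    have e2 := Real.rpow_le_rpow_of_nonpos hn hle (show -(4 * θ) ≤ 0 by linarith)
    gcongr
  · refine (h t ht _ hr hs).trans ?_
    refine le_add_of_nonneg_of_le (by positivity) ?_
    have e2 := Real.rpow_le_rpow_of_nonpos (show 0 < 1 + ‖ξ‖ by linarith)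
      (add_le_add_right hle 1) (show -(n + 1 : ℝ) ≤ 0 by linarith [n.cast_nonneg (α := ℝ)])
    gcongr

theorem exists_norm_fourierSolution_le {n : ℕ} (hn : 1 ≤ n) {θ : ℝ} (h0 : 0 < θ) (h1 : θ < 1 / 2)
    (hnθ : 4 * θ < n) : ∃ K > (0 : ℝ), ∃ T > (0 : ℝ), ∀ t ≥ T, ∀ u₁ : L2 n,
      Integrable (u₁ : EuclideanSpace ℝ (Fin n) → ℂ) →
      ‖fourierSolution θ u₁ t‖ ≤
        K * (∫ x, ‖u₁ x‖) * t ^ (-((n - 4 * θ) / (4 * (1 - θ)))) := by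
  obtain ⟨δ, hδ, T, hT, h⟩ := exists_solutionSymbol_sq_le (n := n) h0 h1
  have : Nonempty (Fin n) := ⟨⟨0, hn⟩⟩
  have hp : 0 < 2 - 2 * θ := by linarith
  set a := (n - 4 * θ) / (4 * (1 - θ)) with ha
  set J := ∫ ξ : EuclideanSpace ℝ (Fin n), Real.exp (-‖ξ‖ ^ (2 - 2 * θ)) * ‖ξ‖ ^ (-(4 * θ))
    with hJ
  have hJ0 : 0 ≤ J := integral_nonneg fun ξ => by positivity
  set I := ∫ ξ : EuclideanSpace ℝ (Fin n), (1 + ‖ξ‖) ^ (-(n + 1 : ℝ)) with hI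
  have hint := integrable_one_add_norm (E := EuclideanSpace ℝ (Fin n)) (μ := volume)
    (r := (n + 1 : ℝ)) (by simp)
  -- The high-frequency part divided by the squared rate `t ^ (-2a)` tends to zero; once it is at
  -- most `1` it accounts for the `+ 1` in the constant. The time is chosen before `u₁`.
  have hlim : Tendsto (fun t : ℝ => 2 ^ (n + 1 : ℝ) * I *
      (t ^ (2 + 2 * a) * Real.exp (-δ * t))) atTop (𝓝 0) := by
    simpa using (tendsto_rpow_mul_exp_neg_mul_atTop_nhds_zero (2 + 2 * a) δ hδ).const_mul
      (2 ^ (n + 1 : ℝ) * I)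
  obtain ⟨T', hT'⟩ := eventually_atTop.1 (hlim.eventually (eventually_le_nhds zero_lt_one))
  refine ⟨√(16 * J + 1), by positivity, max T T', lt_max_of_lt_left hT, fun t ht u₁ hu₁ => ?_⟩
  have htT : T ≤ t := (le_max_left _ _).trans ht
  have ht0 : 0 < t := by linarith
  set M := ∫ x, ‖u₁ x‖ with hM
  have hM0 : 0 ≤ M := integral_nonneg fun x => norm_nonneg _
  have hsmall : 2 ^ (n + 1 : ℝ) * (t ^ 2 * Real.exp (-(δ * t))) * I ≤ t ^ (-(2 * a)) := by
    have := hT' t ((le_max_right _ _).trans ht)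
    rw [Real.rpow_add ht0, Real.rpow_two, neg_mul] at this
    rw [Real.rpow_neg ht0.le, ← one_div, le_div_iff₀ (by positivity)]
    linarith
  have hbound : ‖fourierSolution θ u₁ t‖ ^ 2 ≤ M ^ 2 * ((16 * J + 1) * t ^ (-(2 * a))) := by
    rw [norm_sq_fourierSolution ht0.le]
    have hi := ((integrable_exp_mul_rpow hn hp hnθ ht0).const_mul 16).add
      (hint.const_mul (2 ^ (n + 1 : ℝ) * (t ^ 2 * Real.exp (-(δ * t)))))
    refine (integral_mono_ae (integrable_sq_fourierSolution ht0.le u₁) (hi.const_mul (M ^ 2))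
      ?_).trans ?_
    · filter_upwards [fourier_ae_eq_fourierIntegral u₁ hu₁, Measure.ae_ne volume 0] with ξ e hξ
      rw [e, mul_comm (M ^ 2)]
      refine mul_le_mul (h t htT ξ hξ) ?_ (by positivity)
        ((sq_nonneg _).trans (h t htT ξ hξ))
      exact pow_le_pow_left₀ (norm_nonneg _) (norm_fourierIntegral_le _ ξ) 2
    · rw [integral_const_mul]
      refine mul_le_mul_of_nonneg_left ?_ (sq_nonneg M)
      rw [integral_add' ((integrable_exp_mul_rpow hn hp hnθ ht0).const_mul 16)
        (hint.const_mul _), integral_const_mul, integral_const_mul,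
        integral_exp_mul_rpow hp ht0, ← hJ, ← hI]
      have e : ((n : ℝ) - 4 * θ) / (2 - 2 * θ) = 2 * a := by
        rw [ha]
        have : 1 - θ ≠ 0 := by linarith
        rw [show 2 - 2 * θ = 2 * (1 - θ) by ring]
        field_simp
        ring
      rw [e]
      linarith
  refine abs_le_of_sq_le_sq' ?_ (by positivity) |>.2
  rw [mul_pow, mul_pow, Real.sq_sqrt (by positivity), ← Real.rpow_natCast (t ^ (-a)),
    ← Real.rpow_mul ht0.le, show -a * ((2 : ℕ) : ℝ) = -(2 * a) by push_cast; ring]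
  linarith

/-! ### The lower bound -/

/-- The lower bound of the solution operator at the diffusive frequency scale `t ^ (-1/(2-2θ))`. -/
theorem exists_le_solutionSymbol {n : ℕ} {θ : ℝ} (h0 : 0 < θ) (h1 : θ < 1 / 2) :
    ∃ κ > (0 : ℝ), ∃ T > (0 : ℝ), ∀ t ≥ T, ∀ ξ : EuclideanSpace ℝ (Fin n),
      t ^ (-(2 - 2 * θ)⁻¹) ≤ ‖ξ‖ → ‖ξ‖ ≤ 3 * t ^ (-(2 - 2 * θ)⁻¹) →
        κ * (t ^ (-(2 - 2 * θ)⁻¹)) ^ (-(2 * θ)) ≤ solutionSymbol θ t ξ := by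
  have hp : 0 < 2 - 2 * θ := by linarith
  have hpi : 0 < (2 - 2 * θ)⁻¹ := inv_pos.2 hp
  have hσ0 : Tendsto (fun t : ℝ => t ^ (-(2 - 2 * θ)⁻¹)) atTop (𝓝 0) :=
    tendsto_rpow_neg_atTop hpi
  -- `20` exceeds `6π`, so `2π‖ξ‖ ≤ 20 σ` whenever `‖ξ‖ ≤ 3 σ`.
  have hsmall : Tendsto (fun t : ℝ => (20 * t ^ (-(2 - 2 * θ)⁻¹)) ^ (2 - 4 * θ)) atTop (𝓝 0) := by
    have := (hσ0.const_mul 20).rpow_const (p := 2 - 4 * θ) (Or.inr (by linarith))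
    simpa [Real.zero_rpow (show 2 - 4 * θ ≠ 0 by linarith)] using this
  -- At the scale `σ = t ^ (-1 / (2 - 2θ))`, `σ ^ (2θ) * t` is this positive power of `t`, so the
  -- fast mode is eventually negligible.
  have hexp : 0 < 1 - 2 * θ * (2 - 2 * θ)⁻¹ := by
    rw [sub_pos, ← div_eq_mul_inv, div_lt_one hp]
    linarith
  have hlarge := tendsto_rpow_atTop hexp
  obtain ⟨T, hT⟩ := eventually_atTop.1
    ((hsmall.eventually (eventually_le_nhds (show (0 : ℝ) < 3 / 64 by norm_num))).and
      (hlarge.eventually_ge_atTop 4))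
  set C := Real.exp (-(4 * 20 ^ (2 - 2 * θ))) / (2 * 20 ^ (2 * θ)) with hC
  refine ⟨C, by positivity, max T 1, by positivity, fun t ht ξ hl hu => ?_⟩
  obtain ⟨hs, hb⟩ := hT t ((le_max_left _ _).trans ht)
  have ht0 : 0 < t := zero_lt_one.trans_le ((le_max_right _ _).trans ht)
  set σ := t ^ (-(2 - 2 * θ)⁻¹) with hσ
  have hσpos : 0 < σ := by positivity
  have hl' : σ ≤ 2 * Real.pi * ‖ξ‖ := by nlinarith [Real.pi_gt_three]
  have hu' : 2 * Real.pi * ‖ξ‖ ≤ 20 * σ := by nlinarith [Real.pi_lt_d2, Real.pi_gt_three]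
  have hr : 0 < 2 * Real.pi * ‖ξ‖ := by linarith
  rw [solutionSymbol, logSymbol]
  set r := 2 * Real.pi * ‖ξ‖
  have hrs : r ^ (2 - 4 * θ) ≤ 3 / 64 :=
    (Real.rpow_le_rpow hr.le hu' (by linarith)).trans hs
  have hrt : 4 ≤ r ^ (2 * θ) * t := by
    refine hb.trans ?_
    have : t ^ (1 - 2 * θ * (2 - 2 * θ)⁻¹) = σ ^ (2 * θ) * t := by
      rw [hσ, ← Real.rpow_mul ht0.le, ← Real.rpow_add_one ht0.ne']
      congr 1
      ring
    rw [this]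
    gcongr
  refine le_trans ?_ (le_dampedKernel_of_small h0 h1 hr hrs hrt)
  have e1 : r ^ (2 - 2 * θ) * t ≤ 20 ^ (2 - 2 * θ) := by
    have : σ ^ (2 - 2 * θ) * t = 1 := by
      rw [hσ, ← Real.rpow_mul ht0.le, neg_mul, inv_mul_cancel₀ hp.ne', Real.rpow_neg_one,
        inv_mul_cancel₀ ht0.ne']
    calc r ^ (2 - 2 * θ) * t ≤ (20 * σ) ^ (2 - 2 * θ) * t := by gcongr
      _ = 20 ^ (2 - 2 * θ) * (σ ^ (2 - 2 * θ) * t) := by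
          rw [Real.mul_rpow (by norm_num) hσpos.le, mul_assoc]
      _ = _ := by rw [this, mul_one]
  have e2 : r ^ (2 * θ) ≤ 20 ^ (2 * θ) * σ ^ (2 * θ) := by
    rw [← Real.mul_rpow (by norm_num) hσpos.le]
    gcongr
  have e3 : Real.exp (-(4 * 20 ^ (2 - 2 * θ))) ≤ Real.exp (-(4 * r ^ (2 - 2 * θ) * t)) :=
    Real.exp_le_exp.2 (by linarith)
  calc C * σ ^ (-(2 * θ)) =
        Real.exp (-(4 * 20 ^ (2 - 2 * θ))) / (2 * (20 ^ (2 * θ) * σ ^ (2 * θ))) := by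
        rw [hC, Real.rpow_neg hσpos.le]
        field_simp
    _ ≤ _ := by gcongr

/-- By continuity `|û₁| > |P₁| / 2` near zero, and for large `t` the diffusive annulus lies in that
neighbourhood. Only the time depends on `u₁`, through the size of the neighbourhood. -/
theorem exists_le_norm_fourierSolution {n : ℕ} (hn : 1 ≤ n) {θ : ℝ} (h0 : 0 < θ)
    (h1 : θ < 1 / 2) : ∃ K > (0 : ℝ), ∀ u₁ : L2 n,
      Integrable (u₁ : EuclideanSpace ℝ (Fin n) → ℂ) → ∃ T > (0 : ℝ), ∀ t ≥ T,
        K * ‖∫ x, u₁ x‖ * t ^ (-((n - 4 * θ) / (4 * (1 - θ)))) ≤ ‖fourierSolution θ u₁ t‖ := by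
  obtain ⟨κ, hκ, T, hT, h⟩ := exists_le_solutionSymbol (n := n) h0 h1
  have : Nonempty (Fin n) := ⟨⟨0, hn⟩⟩
  have hp : 0 < 2 - 2 * θ := by linarith
  set a := (n - 4 * θ) / (4 * (1 - θ)) with ha
  set V := (volume : Measure (EuclideanSpace ℝ (Fin n))).real (Metric.ball 0 1) with hV
  have hVpos : 0 < V := ENNReal.toReal_pos (Metric.measure_ball_pos volume 0 one_pos).ne'
    measure_ball_lt_top.ne
  refine ⟨κ / 2 * √V, by positivity, fun u₁ hu₁ => ?_⟩
  set P := ‖∫ x, u₁ x‖ with hP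
  rcases (norm_nonneg (∫ x, u₁ x)).eq_or_lt with hP0 | hPpos
  · refine ⟨1, one_pos, fun t _ => ?_⟩
    rw [hP, ← hP0, mul_zero, zero_mul]
    exact norm_nonneg _
  have hc : Continuous (𝓕 (u₁ : EuclideanSpace ℝ (Fin n) → ℂ)) :=
    VectorFourier.fourierIntegral_continuous Real.continuous_fourierChar
      (by exact continuous_inner) hu₁
  have hF0 : ‖𝓕 (u₁ : EuclideanSpace ℝ (Fin n) → ℂ) 0‖ = P := by
    rw [Real.fourier_eq]
    simp [hP]
  have hnear : ∀ᶠ ξ in 𝓝 (0 : EuclideanSpace ℝ (Fin n)),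
      P / 2 < ‖𝓕 (u₁ : EuclideanSpace ℝ (Fin n) → ℂ) ξ‖ :=
    hc.norm.continuousAt.eventually (lt_mem_nhds
      (show P / 2 < ‖𝓕 (u₁ : EuclideanSpace ℝ (Fin n) → ℂ) 0‖ by rw [hF0]; linarith))
  obtain ⟨ε, hε, hball⟩ := Metric.eventually_nhds_iff.1 hnear
  have hσ0 : Tendsto (fun t : ℝ => 3 * t ^ (-(2 - 2 * θ)⁻¹)) atTop (𝓝 0) := by
    simpa using (tendsto_rpow_neg_atTop (inv_pos.2 hp)).const_mul 3
  obtain ⟨T', hT'⟩ := eventually_atTop.1 (hσ0.eventually (gt_mem_nhds hε))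
  refine ⟨max T T', lt_max_of_lt_left hT, fun t ht => ?_⟩
  have htT : T ≤ t := (le_max_left _ _).trans ht
  have ht0 : 0 < t := by linarith
  have hσε := hT' t ((le_max_right _ _).trans ht)
  set σ := t ^ (-(2 - 2 * θ)⁻¹) with hσ
  have hσpos : 0 < σ := by positivity
  -- A ball of radius `σ` about a point of norm `2σ` lies in the annulus `σ ≤ ‖ξ‖ ≤ 3σ` and has
  -- volume `σ ^ n * V`, which is enough for the rate.
  obtain ⟨e, he⟩ := exists_norm_eq (EuclideanSpace ℝ (Fin n)) (show 0 ≤ 2 * σ by positivity)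
  have hannulus : ∀ ξ ∈ Metric.ball e σ, σ ≤ ‖ξ‖ ∧ ‖ξ‖ ≤ 3 * σ := fun ξ hξ => by
    rw [mem_ball_iff_norm] at hξ
    have h1 := norm_sub_norm_le e ξ
    have h2 := norm_sub_norm_le ξ e
    rw [norm_sub_rev] at h1
    constructor <;> linarith
  have hvol : (volume : Measure (EuclideanSpace ℝ (Fin n))).real (Metric.ball e σ) =
      σ ^ n * V := by
    rw [measureReal_def, Measure.addHaar_ball volume e hσpos.le, finrank_euclideanSpace_fin,
      ENNReal.toReal_mul, ENNReal.toReal_ofReal (by positivity), hV, measureReal_def]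
  have hint := integrable_sq_fourierSolution (θ := θ) ht0.le u₁
  have heq : (fun ξ => solutionSymbol θ t ξ ^ 2 * ‖(𝓕 u₁ : L2 n) ξ‖ ^ 2) =ᵐ[volume]
      fun ξ => solutionSymbol θ t ξ ^ 2 *
        ‖𝓕 (u₁ : EuclideanSpace ℝ (Fin n) → ℂ) ξ‖ ^ 2 := by
    filter_upwards [fourier_ae_eq_fourierIntegral u₁ hu₁] with ξ h
    rw [h]
  have hlow : (κ * σ ^ (-(2 * θ))) ^ 2 * (P / 2) ^ 2 * (σ ^ n * V) ≤
      ‖fourierSolution θ u₁ t‖ ^ 2 := by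
    rw [norm_sq_fourierSolution ht0.le, integral_congr_ae heq, ← hvol]
    refine (setIntegral_ge_of_const_le_real measurableSet_ball measure_ball_lt_top.ne
      (fun ξ hξ => ?_) (hint.congr heq).integrableOn).trans
      (setIntegral_le_integral (hint.congr heq) (.of_forall fun ξ => by positivity))
    obtain ⟨hl, hu⟩ := hannulus ξ hξ
    have h1 := h t htT ξ hl hu
    have h2 := hball (y := ξ) (by rw [dist_zero_right]; linarith)
    gcongr
  refine abs_le_of_sq_le_sq' ?_ (norm_nonneg _) |>.2
  refine le_trans (le_of_eq ?_) hlow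
  have hexp : (σ ^ (-(2 * θ))) ^ 2 * σ ^ n = (t ^ (-a)) ^ 2 := by
    rw [hσ, ← Real.rpow_natCast _ 2, ← Real.rpow_natCast _ n, ← Real.rpow_natCast _ 2,
      ← Real.rpow_mul ht0.le, ← Real.rpow_mul ht0.le, ← Real.rpow_mul ht0.le,
      ← Real.rpow_mul ht0.le, ← Real.rpow_add ht0]
    congr 1
    rw [ha]
    have : 1 - θ ≠ 0 := by linarith
    rw [show 2 - 2 * θ = 2 * (1 - θ) by ring]
    push_cast
    field_simp
    ring
  rw [mul_pow, mul_pow, mul_pow, Real.sq_sqrt hVpos.le, ← hexp]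
  ring

end

theorem theorem1p2 (n : ℕ) (θ : ℝ)
    (hnθ : (n = 1 ∧ 0 < θ ∧ θ < 1 / 4) ∨ (2 ≤ n ∧ 0 < θ ∧ θ ≤ 5 / 12)) :
    ∃ K₁ > (0 : ℝ), ∃ K₂ > (0 : ℝ), ∃ T₀ > (0 : ℝ),
      ∀ u₁ : L2 n, MemWeightedL1 (2 * θ) u₁ →
        ∃ u : ℝ → L2 n, IsMildSolution θ 0 u₁ u ∧
          (∀ v : ℝ → L2 n, IsMildSolution θ 0 u₁ v → Set.EqOn v u (Set.Ici 0)) ∧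
          (∀ t ≥ T₀, ‖u t‖ ≤ K₂ * (‖∫ x, u₁ x‖ + weightedL1Norm (2 * θ) u₁) *
            (t ^ (-((n - 4 * θ) / (4 * (1 - θ)))) +
              1 / Real.sqrt θ * t ^ (-((n - 4 * θ) / (4 * θ))))) ∧
          (∃ T₁ > (0 : ℝ), ∀ t ≥ T₁,
            K₁ * ‖∫ x, u₁ x‖ * t ^ (-((n - 4 * θ) / (4 * (1 - θ)))) ≤ ‖u t‖) := by
  obtain ⟨hn, h0, h1, hnθ'⟩ : 1 ≤ n ∧ 0 < θ ∧ θ < 1 / 2 ∧ 4 * θ < n := by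
    rcases hnθ with ⟨rfl, h0, h1⟩ | ⟨hn, h0, h1⟩
    · exact ⟨le_rfl, h0, by linarith, by push_cast; linarith⟩
    · have : (2 : ℝ) ≤ n := by exact_mod_cast hn
      exact ⟨by omega, h0, by linarith, by linarith⟩
  obtain ⟨K₁, hK₁, hlow⟩ := exists_le_norm_fourierSolution hn h0 h1
  obtain ⟨K₂, hK₂, T₀, hT₀, hup⟩ := exists_norm_fourierSolution_le hn h0 h1 hnθ'
  refine ⟨K₁, hK₁, K₂, hK₂, T₀, hT₀, fun u₁ hu₁ => ⟨fourierSolution θ u₁,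
    isMildSolution_fourierSolution hn h0 h1.le u₁,
    fun v hv => (isMildSolution_fourierSolution hn h0 h1.le u₁).unique h0 h1.le hv,
    fun t ht => (hup t ht u₁ hu₁.1).trans ?_, hlow u₁ hu₁.1⟩⟩
  have ht0 : 0 < t := by linarith
  have hM : ∫ x, ‖u₁ x‖ ≤ ‖∫ x, u₁ x‖ + weightedL1Norm (2 * θ) u₁ :=
    (integral_norm_le_weightedL1Norm hu₁).trans (le_add_of_nonneg_left (norm_nonneg _))
  have hM0 : 0 ≤ ∫ x, ‖u₁ x‖ := integral_nonneg fun x => norm_nonneg _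
  -- The second power of `t` is nonnegative, so it can be added to the bound already obtained.
  have ht2 : t ^ (-((n - 4 * θ) / (4 * (1 - θ)))) ≤ t ^ (-((n - 4 * θ) / (4 * (1 - θ)))) +
      1 / Real.sqrt θ * t ^ (-((n - 4 * θ) / (4 * θ))) :=
    le_add_of_nonneg_right (by positivity)
  have hMK : 0 ≤ K₂ * (‖∫ x, u₁ x‖ + weightedL1Norm (2 * θ) u₁) :=
    mul_nonneg hK₂.le (hM0.trans hM)
  exact mul_le_mul (mul_le_mul_of_nonneg_left hM hK₂.le) ht2 (by positivity) hMK
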